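/- For a finite set $S\subset\mathbb{R}^2$ and $T\subseteq S$, say that $S'\subseteq S$ covers $T$ if every point of $T$ lies in a closed unit-radius disk centred at a point of $S'$; a minimum dominating set (MDS) of $S$ is a minimum-cardinality subset of $S$ that covers $S$. A duper-cell is a union $\mathcal{E}$ of 30 closed regular hexagons of side length $\frac12$, each with two vertical sides, that form three consecutive rows of ten cells of a hexagonal partition of the plane, the middle row being displaced to the right by half a cell width. The model of computation is a real RAM in which each arithmetic operation on real numbers ($+,-,\times,\div,\sqrt{\ }$), each addition or subtraction of natural numbers, each comparison, memory access (with indirect addressing), assignment and control step costs one unit of time; there is no rounding from real to natural numbers and the constants of a program are integers. (1) There is an algorithm that, given a set $S$ of $n$ points in $\mathbb{R}^2$ and the position of a duper-cell $\mathcal{E}$, computes a minimum-cardinality subset $S'\subseteq S$ that covers $S\cap\mathcal{E}$; it always halts and runs in $O(n^{20}\log n)$ time. (2) There is a $\frac52$-factor approximation algorithm for the geometric minimum dominating set problem that runs in $O(n^{20}\log n)$ time: given a set $S$ of $n$ points in $\mathbb{R}^2$, it halts and returns a subset $S'\subseteq S$ that covers $S$ and satisfies $|S'|\le\frac52\,|OPT|$,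 where $OPT$ is a minimum dominating set of $S$. In both parts the program and the constant in the $O$-bound do not depend on $n$ or on the input; the time bound is asserted for all $n\ge 2$. -/

import Mathlib

/-!
# Machine model: a real RAM with unit costs

The store consists of arrays of natural numbers and arrays of real numbers.  An array is referred
to by a fixed name in the program, and its cells are addressed by computed natural numbers.
Natural numbers can be added, subtracted (with truncation at `0`) and compared.  Real numbers can be
added, subtracted, multiplied, divided, put under a square root and compared.  There is no way to
turn a real number into a natural number (no rounding), no multiplication of natural numbers in one
step, and the only constants are integers.  Every operation, memory access, comparison, assignment
and control step costs one unit of time.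
-/

namespace RealRAM

/-- Expressions of natural-number type. -/
inductive NExp where
  | lit (k : ℕ)
  | get (A : ℕ) (i : NExp)
  | add (a b : NExp)
  | sub (a b : NExp)

/-- Expressions of real type. -/
inductive RExp where
  | lit (k : ℤ)
  | get (A : ℕ) (i : NExp)
  | add (x y : RExp)
  | sub (x y : RExp)
  | mul (x y : RExp)
  | div (x y : RExp)
  | sqrt (x : RExp)

/-- Conditions. -/
inductive Cond where
  | nle (a b : NExp)
  | rle (x y : RExp)
  | neg (c : Cond)

/-- Programs. -/
inductive Cmd where
  | skip
  | setN (A : ℕ) (i e : NExp)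
  | setR (A : ℕ) (i : NExp) (x : RExp)
  | seq (P Q : Cmd)
  | ite (c : Cond) (P Q : Cmd)
  | loop (c : Cond) (P : Cmd)

/-- The store: `nat A i` and `real A i` are the contents of cell `i` of the array with name `A`. -/
structure Mem where
  nat : ℕ → ℕ → ℕ
  real : ℕ → ℕ → ℝ

def NExp.eval (m : Mem) : NExp → ℕ
  | .lit k => k
  | .get A i => m.nat A (i.eval m)
  | .add a b => a.eval m + b.eval m
  | .sub a b => a.eval m - b.eval m

def NExp.cost : NExp → ℕ
  | .lit _ => 1
  | .get _ i => 1 + i.cost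
  | .add a b => 1 + a.cost + b.cost
  | .sub a b => 1 + a.cost + b.cost

/-- Division by zero and the square root of a negative number return `0`; a program can avoid both
by a comparison. -/
noncomputable def RExp.eval (m : Mem) : RExp → ℝ
  | .lit k => (k : ℝ)
  | .get A i => m.real A (i.eval m)
  | .add x y => x.eval m + y.eval m
  | .sub x y => x.eval m - y.eval m
  | .mul x y => x.eval m * y.eval m
  | .div x y => x.eval m / y.eval m
  | .sqrt x => Real.sqrt (x.eval m)

def RExp.cost : RExp → ℕ
  | .lit _ => 1
  | .get _ i => 1 + i.cost
  | .add x y => 1 + x.cost + y.cost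
  | .sub x y => 1 + x.cost + y.cost
  | .mul x y => 1 + x.cost + y.cost
  | .div x y => 1 + x.cost + y.cost
  | .sqrt x => 1 + x.cost

def Cond.Holds (m : Mem) : Cond → Prop
  | .nle a b => a.eval m ≤ b.eval m
  | .rle x y => x.eval m ≤ y.eval m
  | .neg c => ¬ c.Holds m

def Cond.cost : Cond → ℕ
  | .nle a b => 1 + a.cost + b.cost
  | .rle x y => 1 + x.cost + y.cost
  | .neg c => 1 + c.cost

/-- Write `v` into cell `i` of the natural-number array `A`. -/
def Mem.writeN (m : Mem) (A i v : ℕ) : Mem :=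
  { m with nat := Function.update m.nat A (Function.update (m.nat A) i v) }

/-- Write `v` into cell `i` of the real array `A`. -/
noncomputable def Mem.writeR (m : Mem) (A i : ℕ) (v : ℝ) : Mem :=
  { m with real := Function.update m.real A (Function.update (m.real A) i v) }

/-- `Exec P m t m'`: the program `P`, started on the store `m`, halts after exactly `t` units of
time with the store `m'`. -/
inductive Exec : Cmd → Mem → ℕ → Mem → Prop
  | skip (m : Mem) : Exec .skip m 1 m
  | setN (A : ℕ) (i e : NExp) (m : Mem) :
      Exec (.setN A i e) m (1 + i.cost + e.cost) (m.writeN A (i.eval m) (e.eval m))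
  | setR (A : ℕ) (i : NExp) (x : RExp) (m : Mem) :
      Exec (.setR A i x) m (1 + i.cost + x.cost) (m.writeR A (i.eval m) (x.eval m))
  | seq {P Q : Cmd} {m m₁ m₂ : Mem} {s t : ℕ} (hP : Exec P m s m₁) (hQ : Exec Q m₁ t m₂) :
      Exec (.seq P Q) m (s + t) m₂
  | iteTrue {c : Cond} {P Q : Cmd} {m m₁ : Mem} {t : ℕ} (hc : c.Holds m) (hP : Exec P m t m₁) :
      Exec (.ite c P Q) m (1 + c.cost + t) m₁
  | iteFalse {c : Cond} {P Q : Cmd} {m m₁ : Mem} {t : ℕ} (hc : ¬ c.Holds m)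
      (hQ : Exec Q m t m₁) :
      Exec (.ite c P Q) m (1 + c.cost + t) m₁
  | loopTrue {c : Cond} {P : Cmd} {m m₁ m₂ : Mem} {s t : ℕ} (hc : c.Holds m)
      (hP : Exec P m s m₁) (hL : Exec (.loop c P) m₁ t m₂) :
      Exec (.loop c P) m (1 + c.cost + s + t) m₂
  | loopFalse {c : Cond} {P : Cmd} {m : Mem} (hc : ¬ c.Holds m) :
      Exec (.loop c P) m (1 + c.cost) m

end RealRAM

/-! # Dominating sets of planar point sets -/

namespace GeomMDS

open RealRAM

/-- The Euclidean plane. -/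
abbrev Plane : Type := EuclideanSpace ℝ (Fin 2)

/-- The closed unit disks centred at the points of `D` cover `T`. -/
def Covers (D : Finset Plane) (T : Set Plane) : Prop :=
  ∀ s ∈ T, ∃ d ∈ D, s ∈ Metric.closedBall d 1

/-- `D` is a subset of `S` whose unit disks cover `T`, of minimum cardinality among all of these. -/
def IsMinCover (S T : Set Plane) (D : Finset Plane) : Prop :=
  (D : Set Plane) ⊆ S ∧ Covers D T ∧
    ∀ D' : Finset Plane, (D' : Set Plane) ⊆ S → Covers D' T → D.card ≤ D'.card

/-- `D` is a dominating set for `S`. -/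
def IsDominatingSet (S : Set Plane) (D : Finset Plane) : Prop :=
  (D : Set Plane) ⊆ S ∧ Covers D S

/-- `D` is a minimum dominating set for `S`. -/
def IsMDS (S : Set Plane) (D : Finset Plane) : Prop :=
  IsDominatingSet S D ∧ ∀ D' : Finset Plane, IsDominatingSet S D' → D.card ≤ D'.card

/-- The closed regular hexagon of side length `1 / 2` with centre `(u, v)` and two vertical sides;
its vertices are `(u, v ± 1/2)` and `(u ± √3/4, v ± 1/4)`. -/
def hexCell (u v : ℝ) : Set Plane :=
  {q | |q 0 - u| ≤ √3 / 4 ∧ |q 0 - u| / √3 + |q 1 - v| ≤ 1 / 2}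

/-- The duper-cell whose lower left cell has centre `a`: 30 cells of a hexagonal partition of the
plane, in three consecutive rows of 10 adjacent cells each, the middle row being displaced by half
the width `√3 / 2` of a cell. -/
def duperCell (a : Plane) : Set Plane :=
  ⋃ (i : Fin 3) (j : Fin 10),
    hexCell (a 0 + √3 / 2 * ((j : ℝ) + if i = 1 then 1 / 2 else 0)) (a 1 + 3 / 4 * (i : ℝ))

/-- The initial store for the points `p 0, …, p (n - 1)`: the number `n` is in cell `0` of the
natural-number array `0`, the coordinates of the points are in the real arrays `0` and `1`, and all
other cells contain `0`. -/
noncomputable def pointsInput {n : ℕ} (p : Fin n → Plane) : Mem where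
  nat A i := if A = 0 ∧ i = 0 then n else 0
  real A i :=
    if h : i < n then
      if A = 0 then p ⟨i, h⟩ 0 else if A = 1 then p ⟨i, h⟩ 1 else 0
    else 0

/-- The same store, with the coordinates of `a` in the first two cells of the real array `2`. -/
noncomputable def pointsCellInput {n : ℕ} (p : Fin n → Plane) (a : Plane) : Mem :=
  ((pointsInput p).writeR 2 0 (a 0)).writeR 2 1 (a 1)

open Classical in
/-- The set of points that a final store reports: the points `p i` for which cell `i` of the
natural-number array `1` contains `1`. -/
noncomputable def output {n : ℕ} (p : Fin n → Plane) (m : Mem) : Finset Plane :=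
  (Finset.univ.filter fun i : Fin n => m.nat 1 (i : ℕ) = 1).image p

end GeomMDS

/-! Both programs rest on one exact routine, `solve`. Sort the centres of a minimum cover `D` of a
target set `T` by abscissa. A target `t` is covered only by centres with abscissa in `[X t - 1, X t
+ 1]`. If every such slab holds at most `w` centres of `D`, then a centre covering `t` is still
among the `w` most recent ones when the sweep passes `X t + 1`. So `D` is a path in a graph of
windows of `w` points, where a step is admissible if the old window covers every target that the
step leaves behind (`Chk`, `MinDom.good`). Conversely, every admissible path from the empty window
to the end yields a cover, whether or not it is sorted or free of repetitions (`Partial.insert`,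
`Partial.last`). A shortest path therefore gives a minimum cover. It is found in a table with one
layer per path length; a layer has `(n + 1) ^ w` windows, each with `n + 1` continuations tested in
time `O(n)`, hence costs `O(n ^ (w + 2))` (`wp_solve`).

The width `w` is bounded by minimality: disks of `D` that serve only targets in `k` cells of
diameter `1` can be exchanged for `k` of these targets (`MinDom.card_le_of_classes`). A hexagon of
side `1/2` has diameter `1` (`InHex.near`). Centres in a slab of width `2` serve targets in a slab
of width `4`, which meets at most `18` cells of a duper-cell. So `w = 18`, and since `D` has at most
`30` points, boundedly many layers of cost `O(n ^ 20)` suffice.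

The approximation does not use duper-cells. It cuts the points into horizontal strips of height `2`,
each starting at the lowest point that remains, and solves every strip exactly. Sixteen hexagons
cover a `4 × 2` rectangle, so `w = 16`; at most `n` strips with at most `n + 1` layers of cost `O(n
^ 18)` again give `O(n ^ 20)`. A disk of an optimal cover can serve at most two strips, so the total
is at most `2 |OPT|` (`Charged.union`), which is better than the factor `5/2`. The logarithm in the
time bound is slack. -/

/-! # A program logic for the real RAM -/

namespace RealRAM

/-- `P`, started on `m`, halts with a running time and a final store that satisfy `Q`. -/
def Wp (P : Cmd) (m : Mem) (Q : ℕ → Mem → Prop) : Prop :=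
  ∃ t m', Exec P m t m' ∧ Q t m'

theorem Wp.conseq {P : Cmd} {m : Mem} {Q Q' : ℕ → Mem → Prop} (h : Wp P m Q)
    (hQ : ∀ t m', Q t m' → Q' t m') : Wp P m Q' := by
  obtain ⟨t, m', h₁, h₂⟩ := h
  exact ⟨t, m', h₁, hQ _ _ h₂⟩

@[simp] theorem wp_skip {m : Mem} {Q : ℕ → Mem → Prop} : Wp .skip m Q ↔ Q 1 m := by
  constructor
  · rintro ⟨t, m', ⟨⟩, h⟩; exact h
  · exact fun h => ⟨_, _, .skip m, h⟩

@[simp] theorem wp_setN {A : ℕ} {i e : NExp} {m : Mem} {Q : ℕ → Mem → Prop} :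
    Wp (.setN A i e) m Q ↔ Q (1 + i.cost + e.cost) (m.writeN A (i.eval m) (e.eval m)) := by
  constructor
  · rintro ⟨t, m', ⟨⟩, h⟩; exact h
  · exact fun h => ⟨_, _, .setN A i e m, h⟩

@[simp] theorem wp_seq {P R : Cmd} {m : Mem} {Q : ℕ → Mem → Prop} :
    Wp (.seq P R) m Q ↔ Wp P m fun s m₁ => Wp R m₁ fun t m₂ => Q (s + t) m₂ := by
  constructor
  · rintro ⟨t, m', ⟨⟩, h⟩
    rename_i hP hQ
    exact ⟨_, _, hP, _, _, hQ, h⟩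
  · rintro ⟨_, _, hP, _, _, hQ, h⟩
    exact ⟨_, _, .seq hP hQ, h⟩

@[simp] theorem wp_ite {c : Cond} {P R : Cmd} {m : Mem} {Q : ℕ → Mem → Prop} :
    Wp (.ite c P R) m Q ↔
      (c.Holds m → Wp P m fun t m' => Q (1 + c.cost + t) m') ∧
      (¬ c.Holds m → Wp R m fun t m' => Q (1 + c.cost + t) m') := by
  constructor
  · rintro ⟨t, m', H, h⟩
    cases H with
    | iteTrue hc hP => exact ⟨fun _ => ⟨_, _, hP, h⟩, fun h' => absurd hc h'⟩
    | iteFalse hc hP => exact ⟨fun h' => absurd h' hc, fun _ => ⟨_, _, hP, h⟩⟩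
  · rintro ⟨h₁, h₂⟩
    by_cases hc : c.Holds m
    · obtain ⟨_, _, hP, h⟩ := h₁ hc
      exact ⟨_, _, .iteTrue hc hP, h⟩
    · obtain ⟨_, _, hP, h⟩ := h₂ hc
      exact ⟨_, _, .iteFalse hc hP, h⟩

/-- A loop with an invariant `I` indexed by the number of completed rounds. -/
theorem Wp.loop {c : Cond} {P : Cmd} (N b : ℕ) (I : ℕ → Mem → Prop) {m : Mem} (h0 : I 0 m)
    (hstep : ∀ k < N, ∀ m, I k m → c.Holds m ∧ Wp P m fun t m' => t ≤ b ∧ I (k + 1) m')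
    (hend : ∀ m, I N m → ¬ c.Holds m) :
    Wp (.loop c P) m fun t m' => t ≤ N * (1 + c.cost + b) + (1 + c.cost) ∧ I N m' := by
  suffices H : ∀ d k, k + d = N → ∀ m, I k m →
      Wp (.loop c P) m fun t m' => t ≤ d * (1 + c.cost + b) + (1 + c.cost) ∧ I N m' from
    H N 0 (by omega) m h0
  intro d
  induction d with
  | zero =>
    intro k hk m hm
    obtain rfl : k = N := by omega
    exact ⟨_, _, .loopFalse (hend m hm), by omega, hm⟩
  | succ d ih =>
    intro k hk m hm
    obtain ⟨hc, s, m₁, h₁, hs, hI⟩ := hstep k (by omega) m hm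
    obtain ⟨t, m₂, h₂, ht, hI'⟩ := ih (k + 1) (by omega) m₁ hI
    exact ⟨_, _, .loopTrue hc h₁ h₂, by rw [Nat.succ_mul]; omega, hI'⟩

theorem nat_writeN (m : Mem) (A i v B : ℕ) :
    (m.writeN A i v).nat B = if B = A then Function.update (m.nat A) i v else m.nat B := by
  simp only [Mem.writeN, Function.update_apply]

@[simp] theorem real_writeN (m : Mem) (A i v : ℕ) : (m.writeN A i v).real = m.real := rfl

/-- The scalar variable that is kept in cell `0` of the natural-number array `A`. -/
abbrev var (A : ℕ) : NExp := .get A (.lit 0)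

abbrev setVar (A : ℕ) (e : NExp) : Cmd := .setN A (.lit 0) e

abbrev lt (a b : NExp) : Cond := .neg (.nle b a)

/-- Run `P` for the values `0, …, lim - 1` of the scalar variable `A`. -/
def forN (A : ℕ) (lim : NExp) (P : Cmd) : Cmd :=
  .seq (setVar A (.lit 0)) (.loop (lt (var A) lim) (.seq P (setVar A (.add (var A) (.lit 1)))))

/-- The limit is evaluated anew in every round, hence `hlim`. The invariant for `k + 1` is required
of the store in which the counter has already been increased; so it may speak about the counter's
array as well. -/
theorem Wp.forN {A : ℕ} {lim : NExp} {P : Cmd} (N b : ℕ) (I : ℕ → Mem → Prop) {m : Mem}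
    (h0 : I 0 (m.writeN A 0 0))
    (hlim : ∀ k m, I k m → lim.eval m = N)
    (hstep : ∀ k < N, ∀ m, I k m → m.nat A 0 = k →
      Wp P m fun t m' => t ≤ b ∧ m'.nat A 0 = k ∧ I (k + 1) (m'.writeN A 0 (k + 1))) :
    Wp (RealRAM.forN A lim P) m fun t m' =>
      t ≤ (N + 1) * (b + lim.cost + 12) ∧ I N m' ∧ m'.nat A 0 = N := by
  unfold RealRAM.forN
  simp only [wp_seq, wp_setN]
  refine (Wp.loop N (b + 6) (fun k m => I k m ∧ m.nat A 0 = k) ?_ ?_ ?_).conseq ?_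
  · exact ⟨h0, by simp [nat_writeN, NExp.eval]⟩
  · rintro k hk m ⟨hI, hA⟩
    refine ⟨by simp [Cond.Holds, NExp.eval, hA, hlim k m hI, hk], ?_⟩
    simp only [wp_seq, wp_setN]
    refine (hstep k hk m hI hA).conseq ?_
    rintro t m' ⟨ht, hA', hI'⟩
    refine ⟨by simp only [NExp.cost]; omega, ?_⟩
    simp only [NExp.eval, hA']
    exact ⟨hI', by simp [nat_writeN]⟩
  · rintro m ⟨hI, hA⟩
    simp [Cond.Holds, NExp.eval, hA, hlim N m hI]
  · rintro t m' ⟨ht, hI, hA⟩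
    refine ⟨?_, hI, hA⟩
    simp only [NExp.cost, Cond.cost] at ht ⊢
    nlinarith

/-- `m'` differs from `m` at most in the natural-number arrays whose names are in `L`. -/
def Same (L : List ℕ) (m m' : Mem) : Prop :=
  m'.real = m.real ∧ ∀ B, B ∉ L → m'.nat B = m.nat B

theorem Same.refl (L : List ℕ) (m : Mem) : Same L m m := ⟨rfl, fun _ _ => rfl⟩

theorem Same.trans {L L' : List ℕ} {m m₁ m₂ : Mem} (h : Same L m m₁) (h' : Same L' m₁ m₂)
    (hL : L' ⊆ L) : Same L m m₂ :=
  ⟨h'.1.trans h.1, fun B hB => (h'.2 B fun h => hB (hL h)).trans (h.2 B hB)⟩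

theorem Same.writeN {L : List ℕ} {m m' : Mem} (h : Same L m m') {A : ℕ} (hA : A ∈ L) (i v : ℕ) :
    Same L m (m'.writeN A i v) := by
  refine ⟨h.1, fun B hB => ?_⟩
  rw [nat_writeN, if_neg (fun e : B = A => hB (e ▸ hA)), h.2 B hB]

end RealRAM

/-! # Minimum covers as shortest paths in a graph of windows

Points are numbered by `0, …, n - 1` and have the coordinates `X i`, `Y i`.  A window of `w` points is
coded by a number below `(n + 1) ^ w`, whose digits to the base `n + 1` are the numbers of the points;
the digit `n` stands for no point, and the digit at `0` is the most recent point. -/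

namespace GeomMDS

open Finset

/-- The unit disk around the point `d` contains the point `t`. -/
def Near (X Y : ℕ → ℝ) (d t : ℕ) : Prop := (X t - X d) ^ 2 + (Y t - Y d) ^ 2 ≤ 1

/-- The unit disks around the points of `D` cover `T`. -/
def Dom (X Y : ℕ → ℝ) (D T : Finset ℕ) : Prop := ∀ t ∈ T, ∃ d ∈ D, Near X Y d t

/-- `D` is a cover of `T` of minimum cardinality. -/
def MinDom (n : ℕ) (X Y : ℕ → ℝ) (D T : Finset ℕ) : Prop :=
  D ⊆ range n ∧ Dom X Y D T ∧ ∀ D' ⊆ range n, Dom X Y D' T → #D ≤ #D'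

theorem Near.refl (X Y : ℕ → ℝ) (d : ℕ) : Near X Y d d := by simp [Near]

theorem Near.abs_le {X Y : ℕ → ℝ} {d t : ℕ} (h : Near X Y d t) : |X t - X d| ≤ 1 := by
  rw [← sq_le_one_iff_abs_le_one]
  unfold Near at h
  nlinarith [sq_nonneg (Y t - Y d)]

theorem Near.abs_snd_le {X Y : ℕ → ℝ} {d t : ℕ} (h : Near X Y d t) : |Y t - Y d| ≤ 1 := by
  rw [← sq_le_one_iff_abs_le_one]
  unfold Near at h
  nlinarith [sq_nonneg (X t - X d)]

/-- `T` covers itself, so the finite family of covers inside `range n` is not empty. -/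
theorem exists_minDom {n : ℕ} {X Y : ℕ → ℝ} {T : Finset ℕ} (hT : T ⊆ range n) :
    ∃ D, MinDom n X Y D T := by
  classical
  obtain ⟨D, hD, hmin⟩ := exists_min_image ((range n).powerset.filter fun D => Dom X Y D T) card
    ⟨T, mem_filter.2 ⟨mem_powerset.2 hT, fun t ht => ⟨t, ht, Near.refl X Y t⟩⟩⟩
  simp only [mem_filter, mem_powerset] at hD hmin
  exact ⟨D, hD.1, hD.2, fun D' h h' => hmin D' ⟨h, h'⟩⟩

/-- If the disks of `W ⊆ D` are responsible only for targets that satisfy `U`, and these fall into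
classes of mutually close targets, then a minimum cover `D` has at most one disk in `W` per class. -/
theorem MinDom.card_le_of_classes {n : ℕ} {X Y : ℕ → ℝ} {D T W : Finset ℕ} (hD : MinDom n X Y D T)
    (hT : T ⊆ range n) (hW : W ⊆ D) {U : ℕ → Prop}
    (hU : ∀ t ∈ T, ∀ d ∈ W, Near X Y d t → U t) {ι : Type*} (J : Finset ι)
    (cls : ℕ → ι) (hJ : ∀ t ∈ T, U t → cls t ∈ J)
    (hcls : ∀ t ∈ T, ∀ t' ∈ T, U t → U t' → cls t = cls t' → Near X Y t t') : #W ≤ #J := by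
  classical
  set J' := (T.filter U).image cls with hJ'
  have hJJ : #J' ≤ #J := card_le_card fun j hj => by
    simp only [hJ', mem_image, mem_filter] at hj
    obtain ⟨t, ⟨h₁, h₂⟩, rfl⟩ := hj
    exact hJ t h₁ h₂
  have hex : ∀ j ∈ J', ∃ t ∈ T, U t ∧ cls t = j := fun j hj => by
    simpa [hJ', and_assoc] using hj
  choose! r hrT hrU hr using hex
  -- The exchange: drop `W` and put one target `r j` of each occurring class in its place. A target
  -- that relied on `W` is near the representative of its class.
  have hcov : Dom X Y ((D \ W) ∪ J'.image r) T := fun t ht => by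
    obtain ⟨d, hd, hdt⟩ := hD.2.1 t ht
    by_cases hdW : d ∈ W
    · have hUt := hU t ht d hdW hdt
      have hj : cls t ∈ J' := by
        rw [hJ', mem_image]; exact ⟨t, mem_filter.2 ⟨ht, hUt⟩, rfl⟩
      refine ⟨r (cls t), mem_union_right _ (mem_image_of_mem _ hj), ?_⟩
      exact hcls _ (hrT _ hj) _ ht (hrU _ hj) hUt (hr _ hj)
    · exact ⟨d, mem_union_left _ (mem_sdiff.2 ⟨hd, hdW⟩), hdt⟩
  have hle := hD.2.2 _ (union_subset (sdiff_subset.trans hD.1)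
    (image_subset_iff.2 fun j hj => hT (hrT j hj))) hcov
  have h₁ := card_union_le (D \ W) (J'.image r)
  have h₂ : #(J'.image r) ≤ #J' := card_image_le
  have h₃ := card_sdiff_add_card_eq_card hW
  omega

/-! ### Digits to the base `n + 1` -/

/-- The digit of `C` with the weight `(n + 1) ^ i`, to the base `n + 1`. -/
def dig (n i C : ℕ) : ℕ := C / (n + 1) ^ i % (n + 1)

theorem dig_le (n i C : ℕ) : dig n i C ≤ n := Nat.lt_succ_iff.1 (Nat.mod_lt _ (Nat.succ_pos n))

theorem dig_zero_append {n u e : ℕ} (he : e ≤ n) : dig n 0 (u * (n + 1) + e) = e := by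
  simp [dig, Nat.add_comm _ e, Nat.add_mul_mod_self_right, Nat.mod_eq_of_lt (Nat.lt_succ_of_le he)]

theorem dig_succ_append {n u e : ℕ} (he : e ≤ n) (i : ℕ) :
    dig n (i + 1) (u * (n + 1) + e) = dig n i u := by
  have : (u * (n + 1) + e) / (n + 1) = u := by
    rw [Nat.add_comm, Nat.add_mul_div_right _ _ (Nat.succ_pos n),
      Nat.div_eq_of_lt (Nat.lt_succ_of_le he), Nat.zero_add]
  unfold dig
  rw [Nat.pow_succ', ← Nat.div_div_eq_div_mul, this]

theorem dig_mod {n w i : ℕ} (hi : i < w) (C : ℕ) : dig n i (C % (n + 1) ^ w) = dig n i C := by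
  unfold dig
  have : (n + 1) ^ w = (n + 1) ^ i * (n + 1) ^ (w - i) := by rw [← pow_add]; congr 1; omega
  rw [this, Nat.mod_mul_right_div_self, Nat.mod_mod_of_dvd]
  exact dvd_pow_self _ (by omega)

/-- `(n + 1) ^ w - 1` is thus the code of the empty window, from which every path starts. -/
theorem dig_pow_sub_one {n w i : ℕ} (hi : i < w) : dig n i ((n + 1) ^ w - 1) = n := by
  induction w generalizing i with
  | zero => omega
  | succ w ih =>
    have h : (n + 1) ^ (w + 1) - 1 = ((n + 1) ^ w - 1) * (n + 1) + n := by
      have : 0 < (n + 1) ^ w := by positivity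
      obtain ⟨k, hk⟩ : ∃ k, (n + 1) ^ w = k + 1 := ⟨_, (Nat.succ_pred_eq_of_pos this).symm⟩
      rw [pow_succ, hk, Nat.add_sub_cancel, Nat.succ_mul]; omega
    rw [h]
    cases i with
    | zero => exact dig_zero_append le_rfl
    | succ i => rw [dig_succ_append le_rfl]; exact ih (by omega)

/-! ### Admissible paths of windows and covers -/

/-- The window with the code `C / (n + 1)` may be followed by the digit `C % (n + 1)`: every target
that lies more than `1` to the left of the latter, but not of the point before, is covered. -/
def Chk (n w : ℕ) (X Y : ℕ → ℝ) (T : Finset ℕ) (C : ℕ) : Prop :=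
  ∀ t ∈ T, (dig n 1 C = n ∨ X (dig n 1 C) ≤ X t + 1) →
    (dig n 0 C = n ∨ X t + 1 < X (dig n 0 C)) →
    ∃ i, 1 ≤ i ∧ i ≤ w ∧ dig n i C < n ∧ Near X Y (dig n i C) t

/-- From the window `u` one can come to an end in at most `r` steps. -/
def Good (n w : ℕ) (X Y : ℕ → ℝ) (T : Finset ℕ) : ℕ → ℕ → Prop
  | 0, _ => False
  | r + 1, u => ∃ e ≤ n, Chk n w X Y T (u * (n + 1) + e) ∧
      (e = n ∨ Good n w X Y T r ((u * (n + 1) + e) % (n + 1) ^ w))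

/-- `O` contains the window `u` and covers all targets but those that a later point may cover. -/
def Partial (n w : ℕ) (X Y : ℕ → ℝ) (T : Finset ℕ) (u : ℕ) (O : Finset ℕ) : Prop :=
  (∀ i < w, dig n i u < n → dig n i u ∈ O) ∧
    ∀ t ∈ T, (∃ d ∈ O, Near X Y d t) ∨ dig n 0 u = n ∨ X (dig n 0 u) ≤ X t + 1

section
variable {n w : ℕ} {X Y : ℕ → ℝ} {T : Finset ℕ}

theorem partial_empty (hw : 0 < w) : Partial n w X Y T ((n + 1) ^ w - 1) ∅ :=
  ⟨fun i hi h => absurd h (by simp [dig_pow_sub_one hi]),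
    fun _ _ => .inr (.inl (dig_pow_sub_one hw))⟩

/-- A target that `O` does not cover has not been passed by the latest point. If the new digit
passes it, then `Chk` finds a point of the window that covers it, and the window is part of `O`. The
order of the points plays no role. -/
theorem Partial.covered {u e : ℕ} {O : Finset ℕ} (h : Partial n w X Y T u O) (he : e ≤ n)
    (hc : Chk n w X Y T (u * (n + 1) + e)) {t : ℕ} (ht : t ∈ T) (hx : e = n ∨ X t + 1 < X e) :
    ∃ d ∈ O, Near X Y d t := by
  rcases h.2 t ht with h' | h'
  · exact h'
  · obtain ⟨i, h₁, h₂, h₃, h₄⟩ := hc t ht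
      (by rwa [dig_succ_append he]) (by rwa [dig_zero_append he])
    obtain ⟨i, rfl⟩ := Nat.exists_eq_add_of_le' h₁
    rw [dig_succ_append he] at h₃ h₄
    exact ⟨_, h.1 i (by omega) h₃, h₄⟩

theorem Partial.last {u : ℕ} {O : Finset ℕ} (h : Partial n w X Y T u O)
    (hc : Chk n w X Y T (u * (n + 1) + n)) : Dom X Y O T :=
  fun _ ht => h.covered le_rfl hc ht (.inl rfl)

theorem Partial.insert {u e : ℕ} {O : Finset ℕ} (hw : 0 < w) (h : Partial n w X Y T u O)
    (he : e < n) (hc : Chk n w X Y T (u * (n + 1) + e)) :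
    Partial n w X Y T ((u * (n + 1) + e) % (n + 1) ^ w) (insert e O) := by
  refine ⟨fun i hi hd => ?_, fun t ht => ?_⟩
  · rw [dig_mod hi] at hd ⊢
    cases i with
    | zero => rw [dig_zero_append he.le]; exact mem_insert_self _ _
    | succ i =>
      rw [dig_succ_append he.le] at hd ⊢
      exact mem_insert_of_mem (h.1 i (by omega) hd)
  · rw [dig_mod hw, dig_zero_append he.le]
    by_cases hx : X e ≤ X t + 1
    · exact .inr (.inr hx)
    · obtain ⟨d, hd, hdt⟩ := h.covered he.le hc ht (.inr (not_le.1 hx))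
      exact .inl ⟨d, mem_insert_of_mem hd, hdt⟩

/-- The code of the window that the most recent points in the list `q` form. -/
def winCode (n w : ℕ) : List ℕ → ℕ
  | [] => (n + 1) ^ w - 1
  | e :: q => (winCode n w q * (n + 1) + e) % (n + 1) ^ w

theorem dig_winCode {q : List ℕ} (hq : ∀ e ∈ q, e ≤ n) {i : ℕ} (hi : i < w) :
    dig n i (winCode n w q) = q.getD i n := by
  induction q generalizing i with
  | nil => simpa [winCode] using dig_pow_sub_one hi
  | cons e q ih =>
    rw [winCode, dig_mod hi]
    have he := hq e (by simp)
    cases i with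
    | zero => rw [dig_zero_append he]; rfl
    | succ i => rw [dig_succ_append he, ih (fun x hx => hq x (by simp [hx])) (by omega)]; rfl

/-- Here `q` holds the centres already swept, the latest first, and `suf` the remaining ones. A
centre that covers a target left behind by `e` cannot lie in `suf`, since everything there is at
least as far to the right as `e`. It has to be shown that it sits among the first `w` entries of
`q`. -/
theorem chk_of_sorted {q suf : List ℕ} (hlt : ∀ d ∈ q.reverse ++ suf, d < n)
    (hord : (q.reverse ++ suf).Pairwise fun a b => X a ≤ X b) (hnd : (q.reverse ++ suf).Nodup)
    (hcov : ∀ t ∈ T, ∃ d ∈ q.reverse ++ suf, Near X Y d t)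
    (hwin : ∀ c : ℝ, #((q.reverse ++ suf).toFinset.filter fun d => |X d - c| ≤ 1) ≤ w)
    (hw : 0 < w) {e : ℕ} (he : e ≤ n) (hes : ∀ d ∈ suf, X e ≤ X d ∧ e < n) :
    Chk n w X Y T (winCode n w q * (n + 1) + e) := by
  intro t ht ha hb
  rw [dig_zero_append he] at hb
  obtain ⟨d, hd, hdt⟩ := hcov t ht
  have hdx := abs_le.1 hdt.abs_le
  have hqn : ∀ d ∈ q, d < n := fun d hd => hlt d (by simp [hd])
  have hdq : d ∈ q := by
    rcases List.mem_append.1 hd with h | h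
    · exact List.mem_reverse.1 h
    · obtain ⟨h₁, h₂⟩ := hes d h
      rcases hb with hb | hb
      · omega
      · linarith
  obtain ⟨i, hi, rfl⟩ := List.mem_iff_getElem.1 hdq
  have hsort : q.Pairwise fun a b => X b ≤ X a :=
    List.pairwise_reverse.1 (List.pairwise_append.1 hord).1
  have hqnd : q.Nodup := List.nodup_reverse.1 (List.nodup_append.1 hnd).1
  by_cases hiw : i < w
  · refine ⟨i + 1, by omega, by omega, ?_⟩
    rw [dig_succ_append he, dig_winCode (fun x hx => (hqn x hx).le) hiw,
      List.getD_eq_getElem _ _ hi]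
    exact ⟨hqn _ hdq, hdt⟩
  -- Otherwise `q[0], …, q[i]` are at least `w + 1` distinct centres. By the sorting they lie
  -- between `q[i]`, which is near `t`, and `q[0]`, which has not passed `X t + 1`; so all of them
  -- are in the slab around `X t`.
  · exfalso
    have h0 : X q[0] ≤ X t + 1 := by
      rw [dig_succ_append he, dig_winCode (fun x hx => (hqn x hx).le) hw,
        List.getD_eq_getElem _ _ (by omega)] at ha
      rcases ha with ha | ha
      · exact absurd ha (hqn _ (List.getElem_mem _)).ne
      · exact ha
    have hmono : ∀ a b (hb : b < q.length) (hab : a ≤ b), X q[b] ≤ X (q[a]'(by omega)) := by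
      intro a b hb hab
      rcases hab.eq_or_lt with rfl | hab
      · exact le_rfl
      · exact List.pairwise_iff_getElem.1 hsort a b (by omega) hb hab
    have hsub : (q.take (i + 1)).toFinset ⊆
        (q.reverse ++ suf).toFinset.filter fun d => |X d - X t| ≤ 1 := by
      intro x hx
      obtain ⟨j, hj, rfl⟩ := List.mem_iff_getElem.1 (List.mem_toFinset.1 hx)
      rw [List.length_take] at hj
      simp only [List.getElem_take, mem_filter, List.mem_toFinset, List.mem_append,
        List.mem_reverse]
      refine ⟨.inl (List.getElem_mem _), abs_le.2 ⟨?_, ?_⟩⟩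
      · have := hmono j i hi (by omega); linarith
      · have := hmono 0 j (by omega) (by omega); linarith
    have h₁ := card_le_card hsub
    rw [List.toFinset_card_of_nodup (hqnd.sublist (List.take_sublist _ _)), List.length_take] at h₁
    have h₂ := hwin (X t)
    omega

/-- Induction on the part of the list still to come; the `+ 1` counts the final step with the digit
`n`. -/
theorem good_of_sorted (hw : 0 < w) {l : List ℕ} (hlt : ∀ d ∈ l, d < n)
    (hord : l.Pairwise fun a b => X a ≤ X b) (hnd : l.Nodup)
    (hcov : ∀ t ∈ T, ∃ d ∈ l, Near X Y d t)
    (hwin : ∀ c : ℝ, #(l.toFinset.filter fun d => |X d - c| ≤ 1) ≤ w) (suf q : List ℕ)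
    (hl : q.reverse ++ suf = l) : Good n w X Y T (suf.length + 1) (winCode n w q) := by
  induction suf generalizing q with
  | nil =>
    subst hl
    exact ⟨n, le_rfl, chk_of_sorted hlt hord hnd hcov hwin hw le_rfl (by simp), .inl rfl⟩
  | cons e suf ih =>
    have h := ih (e :: q) (by rw [← hl]; simp)
    subst hl
    have he : e < n := hlt e (by simp)
    refine ⟨e, he.le, chk_of_sorted hlt hord hnd hcov hwin hw he.le fun d hd => ⟨?_, he⟩, .inr h⟩
    rcases List.mem_cons.1 hd with rfl | hd
    · exact le_rfl
    · exact (List.pairwise_cons.1 (List.pairwise_append.1 hord).2.1).1 d hd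

theorem MinDom.good {D : Finset ℕ} (hw : 0 < w) (hD : MinDom n X Y D T)
    (hwin : ∀ c : ℝ, #(D.filter fun d => |X d - c| ≤ 1) ≤ w) :
    Good n w X Y T (#D + 1) ((n + 1) ^ w - 1) := by
  classical
  set l := D.toList.insertionSort fun a b => X a ≤ X b with hl
  have hperm : l.Perm D.toList := List.perm_insertionSort _ _
  have hmem : ∀ d, d ∈ l ↔ d ∈ D := fun d => by rw [hperm.mem_iff, mem_toList]
  have hfin : l.toFinset = D := by ext d; rw [List.mem_toFinset, hmem]
  have : Std.Total fun a b => X a ≤ X b := ⟨fun a b => le_total _ _⟩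
  have : IsTrans ℕ fun a b => X a ≤ X b := ⟨fun a b c => le_trans⟩
  have h := good_of_sorted (n := n) (Y := Y) (T := T) hw
    (fun d hd => mem_range.1 (hD.1 ((hmem d).1 hd)))
    (List.pairwise_insertionSort (fun a b => X a ≤ X b) D.toList)
    (hperm.nodup_iff.2 D.nodup_toList)
    (fun t ht => by
      obtain ⟨d, hd, h⟩ := hD.2.1 t ht
      exact ⟨d, (hmem d).2 hd, h⟩)
    (by rw [hfin]; exact hwin) l [] rfl
  rwa [hperm.length_eq, length_toList] at h

end
end GeomMDS

/-! # A program for minimum covers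

The natural-number arrays of the program: `0` holds the number of points, `1` the output flags, `2` the
target flags, `4` the table of the path search, `5` the powers of `n + 1`, `6` the digits of the current
code and `7` its remainders; the arrays from `8` on hold scalar variables. -/

namespace GeomMDS

open Finset RealRAM

/-- Run `P` if one of two conditions holds, and `R` otherwise. -/
def iteOr (c c' : Cond) (P R : Cmd) : Cmd := .ite c P (.ite c' P R)

theorem wp_iteOr {c c' : Cond} {P R : Cmd} {m : Mem} {b : ℕ} {Q : Mem → Prop}
    (h : c.Holds m ∨ c'.Holds m → Wp P m fun t m' => t ≤ b ∧ Q m')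
    (h' : ¬ c.Holds m → ¬ c'.Holds m → Wp R m fun t m' => t ≤ b ∧ Q m') :
    Wp (iteOr c c' P R) m fun t m' => t ≤ b + c.cost + c'.cost + 2 ∧ Q m' := by
  unfold iteOr
  rw [wp_ite]
  refine ⟨fun hc => (h (.inl hc)).conseq fun t m' H => ⟨by omega, H.2⟩, fun hc => ?_⟩
  rw [wp_ite]
  exact ⟨fun hc' => (h (.inr hc')).conseq fun t m' H => ⟨by omega, H.2⟩,
    fun hc' => (h' hc hc').conseq fun t m' H => ⟨by omega, H.2⟩⟩

/-- For loops whose number of rounds is not known beforehand, such as the walk through the table;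
the rest of the loop is then handled by induction. -/
theorem wp_loop_unfold {c : Cond} {P : Cmd} {m : Mem} {Q : ℕ → Mem → Prop}
    (h : c.Holds m → Wp P m fun s m₁ => Wp (.loop c P) m₁ fun t m₂ => Q (1 + c.cost + s + t) m₂)
    (h' : ¬ c.Holds m → Q (1 + c.cost) m) : Wp (.loop c P) m Q := by
  by_cases hc : c.Holds m
  · obtain ⟨_, _, h₁, _, _, h₂, h₃⟩ := h hc
    exact ⟨_, _, .loopTrue hc h₁ h₂, h₃⟩
  · exact ⟨_, _, .loopFalse hc, h' hc⟩

/-! ### Powers and digits by repeated addition and subtraction -/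

/-- Store the powers of `n + 1` up to the exponent `w` in array `5`. -/
def powers (w : ℕ) : Cmd :=
  .seq (.setN 5 (.lit 0) (.lit 1))
    (forN 8 (.lit w)
      (.seq (.setN 5 (.add (var 8) (.lit 1)) (.lit 0))
        (forN 9 (.add (var 0) (.lit 1))
          (.setN 5 (.add (var 8) (.lit 1))
            (.add (.get 5 (.add (var 8) (.lit 1))) (.get 5 (var 8)))))))

theorem wp_powers (w : ℕ) {n : ℕ} {m : Mem} (hn : m.nat 0 0 = n) :
    Wp (powers w) m fun t m' => t ≤ 200 * (w + 1) * (n + 1) ∧ Same [5, 8, 9] m m' ∧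
      ∀ i ≤ w, m'.nat 5 i = (n + 1) ^ i := by
  unfold powers
  simp only [wp_seq, wp_setN]
  refine (Wp.forN w (60 * (n + 2)) (fun k m' => Same [5, 8, 9] m m' ∧
      ∀ i ≤ k, m'.nat 5 i = (n + 1) ^ i) ?_ (fun _ _ _ => rfl) ?_).conseq ?_
  · refine ⟨((Same.refl _ m).writeN (by decide) _ _).writeN (by decide) _ _, fun i hi => ?_⟩
    obtain rfl : i = 0 := by omega
    simp [nat_writeN, NExp.eval]
  · rintro k hk m₁ ⟨hS, hp⟩ h8
    simp only [wp_seq, wp_setN]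
    -- There is no multiplication of natural numbers: the next power is the sum of `n + 1` copies of
    -- the last one, and after `j` rounds `j` copies have been added.
    refine (Wp.forN (n + 1) 20 (fun j m' => Same [5, 8, 9] m m' ∧ m'.nat 8 0 = k ∧
      (∀ i ≤ k, m'.nat 5 i = (n + 1) ^ i) ∧ m'.nat 5 (k + 1) = j * (n + 1) ^ k)
      ?_ ?_ ?_).conseq ?_
    · refine ⟨(hS.writeN (by decide) _ _).writeN (by decide) _ _, ?_, ?_, ?_⟩
      · simpa [nat_writeN] using h8
      · intro i hi
        simp [nat_writeN, NExp.eval, h8, Function.update_apply, hp i hi]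
        omega
      · simp [nat_writeN, NExp.eval, h8]
    · rintro j m' ⟨hS', -⟩
      simp [NExp.eval, hS'.2 0 (by decide), hn]
    · rintro j hj m' ⟨hS', h8', hp', hj'⟩ h9
      simp only [wp_setN]
      refine ⟨by simp [NExp.cost], by simpa [nat_writeN] using h9,
        (hS'.writeN (by decide) _ _).writeN (by decide) _ _, ?_, ?_, ?_⟩
      · simpa [nat_writeN] using h8'
      · intro i hi
        simp [nat_writeN, NExp.eval, h8', Function.update_apply, hp' i hi]
        omega
      · simp [nat_writeN, NExp.eval, h8', hj', hp' k le_rfl]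
        ring
    · rintro t m' ⟨ht, ⟨hS', h8', hp', hj'⟩, -⟩
      refine ⟨?_, h8', hS'.writeN (by decide) _ _, ?_⟩
      · simp only [NExp.cost] at ht ⊢
        omega
      · intro i hi
        rw [nat_writeN, if_neg (by decide)]
        rcases hi.eq_or_lt with rfl | hi
        · rw [hj', pow_succ, mul_comm]
        · exact hp' i (by omega)
  · rintro t m' ⟨ht, ⟨hS, hp⟩, -⟩
    refine ⟨?_, hS, hp⟩
    simp only [NExp.cost] at ht ⊢
    nlinarith

/-- Write the digits of the code in the variable `10` into array `6`, and its remainders modulo the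
powers of `n + 1` into array `7`. -/
def decode (w : ℕ) : Cmd :=
  let j : NExp := .sub (.lit w) (var 8)
  .seq (.setN 7 (.lit (w + 1)) (var 10))
    (forN 8 (.lit (w + 1))
      (.seq (.setN 7 j (.get 7 (.add j (.lit 1))))
        (.seq (.setN 6 j (.lit 0))
          (.loop (.nle (.get 5 j) (.get 7 j))
            (.seq (.setN 7 j (.sub (.get 7 j) (.get 5 j)))
              (.setN 6 j (.add (.get 6 j) (.lit 1))))))))

/-- Digits are found from the top down. The remainder modulo `(n + 1) ^ (i + 1)`, divided by `(n +
1) ^ i` by repeated subtraction, leaves the digit at `i` as quotient and the next remainder. Each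
quotient is at most `n`, so the time is linear in `n`. -/
theorem wp_decode {w n C : ℕ} {m : Mem} (hC : m.nat 10 0 = C) (hlt : C < (n + 1) ^ (w + 1))
    (hp : ∀ i ≤ w, m.nat 5 i = (n + 1) ^ i) :
    Wp (decode w) m fun t m' => t ≤ 200 * (w + 1) * (n + 1) ∧ Same [6, 7, 8] m m' ∧
      ∀ i ≤ w, m'.nat 6 i = dig n i C ∧ m'.nat 7 i = C % (n + 1) ^ i := by
  unfold decode
  simp only [wp_seq, wp_setN]
  refine (Wp.forN (w + 1) (50 * (n + 1)) (fun k m' => Same [6, 7, 8] m m' ∧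
      ∀ i, w + 1 ≤ i + k → i ≤ w + 1 →
        m'.nat 7 i = C % (n + 1) ^ i ∧ (i ≤ w → m'.nat 6 i = dig n i C))
      ?_ (fun _ _ _ => rfl) ?_).conseq ?_
  · refine ⟨((Same.refl _ m).writeN (by decide) _ _).writeN (by decide) _ _, fun i hi hi' => ?_⟩
    obtain rfl : i = w + 1 := by omega
    simp [nat_writeN, NExp.eval, hC, Nat.mod_eq_of_lt hlt]
  · rintro k hk m₁ ⟨hS, hd⟩ h8
    -- Round `k` treats the position `i = w - k`.
    obtain ⟨i, rfl⟩ : ∃ i, w = i + k := ⟨w - k, by omega⟩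
    have hi1 := (hd (i + 1) (by omega) (by omega)).1
    set R := C % (n + 1) ^ (i + 1) with hR
    have hq : R / (n + 1) ^ i = dig n i C := by
      rw [hR, pow_succ, Nat.mod_mul_right_div_self, dig]
    have hr : R % (n + 1) ^ i = C % (n + 1) ^ i := by
      rw [hR]; exact Nat.mod_mod_of_dvd _ (pow_dvd_pow _ (by omega))
    have h5 : ∀ m', Same [6, 7, 8] m m' → m'.nat 5 i = (n + 1) ^ i := fun m' h => by
      rw [h.2 5 (by decide), hp i (by omega)]
    have hpos : 0 < (n + 1) ^ i := by positivity
    simp only [wp_seq, wp_setN]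
    refine (Wp.loop (dig n i C) 35 (fun j m' => Same [6, 7, 8] m m' ∧ m'.nat 8 0 = k ∧
      (∀ l, i + 1 ≤ l → m'.nat 7 l = m₁.nat 7 l ∧ m'.nat 6 l = m₁.nat 6 l) ∧
      m'.nat 7 i + j * (n + 1) ^ i = R ∧ m'.nat 6 i = j) ?_ ?_ ?_).conseq ?_
    · refine ⟨(hS.writeN (by decide) _ _).writeN (by decide) _ _, ?_, ?_, ?_, ?_⟩
      · simpa [nat_writeN] using h8
      · intro l hl
        have : l ≠ i := by omega
        simp [nat_writeN, NExp.eval, h8, this]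
      · simp [nat_writeN, NExp.eval, h8, hi1]
      · simp [nat_writeN, NExp.eval, h8]
    · rintro j hj m' ⟨hS', h8', hl, h7, h6⟩
      have hle : (n + 1) ^ i ≤ m'.nat 7 i := by
        have := Nat.div_add_mod R ((n + 1) ^ i)
        rw [hq] at this
        generalize R % (n + 1) ^ i = ρ at this
        have h₂ := Nat.mul_le_mul_left ((n + 1) ^ i) (Nat.succ_le_of_lt hj)
        rw [Nat.mul_succ, Nat.mul_comm _ j] at h₂
        omega
      have h5' := h5 m' hS'
      refine ⟨by simpa [Cond.Holds, NExp.eval, h8', h5'] using hle, ?_⟩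
      simp only [wp_seq, wp_setN]
      refine ⟨by simp [NExp.cost], (hS'.writeN (by decide) _ _).writeN (by decide) _ _, ?_, ?_,
        ?_, ?_⟩
      · simpa [nat_writeN] using h8'
      · intro l hl'
        have : l ≠ i := by omega
        simpa [nat_writeN, NExp.eval, h8', Function.update_apply, this] using hl l hl'
      · simp [nat_writeN, NExp.eval, h8', h5', Nat.succ_mul]
        omega
      · simp [nat_writeN, NExp.eval, h8', h6]
    · rintro m' ⟨hS', h8', hl, h7, h6⟩
      have hlt' : m'.nat 7 i < (n + 1) ^ i := by
        have h₁ := Nat.div_add_mod R ((n + 1) ^ i)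
        have h₂ := Nat.mod_lt R hpos
        rw [hq] at h₁
        nlinarith
      simpa [Cond.Holds, NExp.eval, h8', h5 m' hS'] using hlt'
    · rintro t m' ⟨ht, hS', h8', hl, h7, h6⟩
      refine ⟨?_, h8', hS'.writeN (by decide) _ _, ?_⟩
      · have := dig_le n i C
        simp only [NExp.cost, Cond.cost] at ht ⊢
        nlinarith
      · intro l hl₁ hl₂
        simp only [nat_writeN, if_neg (show (7 : ℕ) ≠ 8 by decide),
          if_neg (show (6 : ℕ) ≠ 8 by decide)]
        rcases (show i ≤ l by omega).eq_or_lt with rfl | hil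
        · refine ⟨?_, fun _ => h6⟩
          have := Nat.div_add_mod R ((n + 1) ^ i)
          rw [hq, hr] at this
          nlinarith
        · rw [(hl l hil).1, (hl l hil).2]
          exact hd l (by omega) hl₂
  · rintro t m' ⟨ht, ⟨hS, hd⟩, -⟩
    refine ⟨?_, hS, fun i hi => ⟨(hd i (by omega) (by omega)).2 hi, (hd i (by omega) (by omega)).1⟩⟩
    simp only [NExp.cost] at ht ⊢
    nlinarith

/-! ### Testing whether a window may be extended -/

/-- The store `m` contains the points, the targets and the powers of `n + 1`. -/
structure Loaded (n w : ℕ) (X Y : ℕ → ℝ) (T : Finset ℕ) (m : Mem) : Prop where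
  size : m.nat 0 0 = n
  fst : m.real 0 = X
  snd : m.real 1 = Y
  sub : T ⊆ range n
  tgt : ∀ t < n, 1 ≤ m.nat 2 t ↔ t ∈ T
  pow : ∀ i ≤ w, m.nat 5 i = (n + 1) ^ i

section
variable {n w : ℕ} {X Y : ℕ → ℝ} {T : Finset ℕ}

theorem Loaded.of_same {m m' : Mem} {L : List ℕ} (h : Loaded n w X Y T m) (hS : Same L m m')
    (h0 : 0 ∉ L := by decide) (h2 : 2 ∉ L := by decide) (h5 : 5 ∉ L := by decide) :
    Loaded n w X Y T m' where
  size := by rw [hS.2 0 h0, h.size]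
  fst := by rw [hS.1, h.fst]
  snd := by rw [hS.1, h.snd]
  sub := h.sub
  tgt := by rw [hS.2 2 h2]; exact h.tgt
  pow := by rw [hS.2 5 h5]; exact h.pow

/-- The condition that the point `t` lies in the unit disk around the point `d`. -/
def nearCond (d t : NExp) : Cond :=
  .rle (.add (.mul (.sub (.get 0 t) (.get 0 d)) (.sub (.get 0 t) (.get 0 d)))
    (.mul (.sub (.get 1 t) (.get 1 d)) (.sub (.get 1 t) (.get 1 d)))) (.lit 1)

theorem holds_nearCond {d t : NExp} {m : Mem} :
    (nearCond d t).Holds m ↔ Near (m.real 0) (m.real 1) (d.eval m) (t.eval m) := by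
  simp [nearCond, Cond.Holds, RExp.eval, Near, sq]

/-- Set the variable `15` to `1` if the target in the variable `13` is covered by a point among the
digits from `1` on, and to `0` otherwise. -/
def coverTest (w : ℕ) : Cmd :=
  let d : NExp := .get 6 (.add (var 14) (.lit 1))
  .seq (setVar 15 (.lit 0))
    (forN 14 (.lit w)
      (.ite (lt d (var 0)) (.ite (nearCond d (var 13)) (setVar 15 (.lit 1)) .skip) .skip))

theorem wp_coverTest {t C : ℕ} {m : Mem} (h : Loaded n w X Y T m)
    (hd : ∀ i ≤ w, m.nat 6 i = dig n i C) (ht : m.nat 13 0 = t) :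
    Wp (coverTest w) m fun s m' => s ≤ 200 * (w + 1) ∧ Same [14, 15] m m' ∧
      (1 ≤ m'.nat 15 0 ↔ ∃ i, 1 ≤ i ∧ i ≤ w ∧ dig n i C < n ∧ Near X Y (dig n i C) t) := by
  unfold coverTest
  simp only [wp_seq, wp_setN]
  refine (Wp.forN w 80 (fun k m' => Same [14, 15] m m' ∧
      (1 ≤ m'.nat 15 0 ↔ ∃ i, 1 ≤ i ∧ i ≤ k ∧ dig n i C < n ∧ Near X Y (dig n i C) t))
      ?_ (fun _ _ _ => rfl) ?_).conseq ?_
  · refine ⟨((Same.refl _ m).writeN (by decide) _ _).writeN (by decide) _ _, ?_⟩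
    simp only [nat_writeN, NExp.eval]
    simp
  · rintro k hk m₁ ⟨hS, hc⟩ h14
    have h₁ := h.of_same hS
    have e6 : m₁.nat 6 (k + 1) = dig n (k + 1) C := by
      rw [hS.2 6 (by decide), hd _ (by omega)]
    have e13 : m₁.nat 13 0 = t := by rw [hS.2 13 (by decide), ht]
    have hext : (∃ i, 1 ≤ i ∧ i ≤ k + 1 ∧ dig n i C < n ∧ Near X Y (dig n i C) t) ↔
        (∃ i, 1 ≤ i ∧ i ≤ k ∧ dig n i C < n ∧ Near X Y (dig n i C) t) ∨
          (dig n (k + 1) C < n ∧ Near X Y (dig n (k + 1) C) t) := by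
      constructor
      · rintro ⟨i, h₁, h₂, h₃⟩
        rcases h₂.eq_or_lt with rfl | h₂
        · exact .inr h₃
        · exact .inl ⟨i, h₁, by omega, h₃⟩
      · rintro (⟨i, h₁, h₂, h₃⟩ | h₃)
        · exact ⟨i, h₁, by omega, h₃⟩
        · exact ⟨k + 1, by omega, le_rfl, h₃⟩
    simp only [wp_ite, wp_setN, wp_skip, holds_nearCond, hext]
    simp only [Cond.Holds, NExp.eval, e6, e13, h14, h₁.size, h₁.fst, h₁.snd, not_le, not_lt]
    refine ⟨fun hlt => ⟨fun hN => ?_, fun hN => ?_⟩, fun hlt => ?_⟩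
    · refine ⟨by decide, by simpa [nat_writeN] using h14,
        (hS.writeN (by decide) _ _).writeN (by decide) _ _, ?_⟩
      simp [nat_writeN, hN, hlt]
    · refine ⟨by decide, trivial, hS.writeN (by decide) _ _, ?_⟩
      simp [nat_writeN, hN, hc]
    · refine ⟨by decide, trivial, hS.writeN (by decide) _ _, ?_⟩
      simp [nat_writeN, hlt.not_gt, hc]
  · rintro s m' ⟨hs, ⟨hS, hc⟩, -⟩
    refine ⟨?_, hS, hc⟩
    simp only [NExp.cost] at hs ⊢
    omega

/-- Set the variable `16` to `1` if the code whose digits are in array `6` satisfies `Chk`, and to `0`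
otherwise. -/
def windowTest (w : ℕ) : Cmd :=
  let a : NExp := .get 6 (.lit 1)
  let b : NExp := .get 6 (.lit 0)
  let x : RExp := .add (.get 0 (var 13)) (.lit 1)
  .seq (setVar 16 (.lit 1))
    (forN 13 (var 0)
      (.ite (.nle (.lit 1) (.get 2 (var 13)))
        (iteOr (.nle (var 0) a) (.rle (.get 0 a) x)
          (iteOr (.nle (var 0) b) (.neg (.rle (.get 0 b) x))
            (.seq (coverTest w)
              (.ite (.nle (.lit 1) (var 15)) .skip (setVar 16 (.lit 0)))) .skip) .skip) .skip))

theorem wp_windowTest {C : ℕ} {m : Mem} (hw : 0 < w) (h : Loaded n w X Y T m)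
    (hd : ∀ i ≤ w, m.nat 6 i = dig n i C) :
    Wp (windowTest w) m fun s m' => s ≤ 400 * (w + 1) * (n + 1) ∧ Same [13, 14, 15, 16] m m' ∧
      (1 ≤ m'.nat 16 0 ↔ Chk n w X Y T C) := by
  set A : ℕ → Prop := fun t => (dig n 1 C = n ∨ X (dig n 1 C) ≤ X t + 1) with hA
  set B : ℕ → Prop := fun t => (dig n 0 C = n ∨ X t + 1 < X (dig n 0 C)) with hB
  set V : ℕ → Prop := fun t => ∃ i, 1 ≤ i ∧ i ≤ w ∧ dig n i C < n ∧ Near X Y (dig n i C) t with hV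
  unfold windowTest
  simp only [wp_seq, wp_setN]
  refine (Wp.forN n (200 * (w + 1) + 80) (fun k m' => Same [13, 14, 15, 16] m m' ∧
      (1 ≤ m'.nat 16 0 ↔ ∀ t < k, t ∈ T → A t → B t → V t)) ?_ ?_ ?_).conseq ?_
  · refine ⟨((Same.refl _ m).writeN (by decide) _ _).writeN (by decide) _ _, ?_⟩
    simp [nat_writeN, NExp.eval]
  · rintro k m' ⟨hS, -⟩
    simp [NExp.eval, hS.2 0 (by decide), h.size]
  · rintro k hk m₁ ⟨hS, hc⟩ h13
    have h₁ := h.of_same hS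
    have e0 : m₁.nat 6 0 = dig n 0 C := by rw [hS.2 6 (by decide), hd _ (by omega)]
    have e1 : m₁.nat 6 1 = dig n 1 C := by rw [hS.2 6 (by decide), hd _ (by omega)]
    have hext : (∀ t < k + 1, t ∈ T → A t → B t → V t) ↔
        (∀ t < k, t ∈ T → A t → B t → V t) ∧ (k ∈ T → A k → B k → V k) := by
      constructor
      · exact fun H => ⟨fun t ht => H t (by omega), H k (by omega)⟩
      · rintro ⟨H, H'⟩ t ht
        rcases (Nat.lt_succ_iff.1 ht).eq_or_lt with rfl | ht
        · exact H'
        · exact H t ht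
    -- All branches that leave the verdict alone share this argument: the implication for the target
    -- `k` holds, so the condition up to `k + 1` is equivalent to that up to `k`.
    have hskip : (k ∈ T → A k → B k → V k) → ∀ b, 1 ≤ b → Wp .skip m₁ fun t m' => t ≤ b ∧
        m'.nat 13 0 = k ∧ Same [13, 14, 15, 16] m (m'.writeN 13 0 (k + 1)) ∧
        (1 ≤ (m'.writeN 13 0 (k + 1)).nat 16 0 ↔ ∀ t < k + 1, t ∈ T → A t → B t → V t) := by
      intro H b hb
      rw [wp_skip, hext]
      exact ⟨hb, h13, hS.writeN (by decide) _ _, by simp [nat_writeN, hc]; exact fun _ => H⟩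
    have hdle := dig_le n
    rw [wp_ite]
    refine ⟨fun hT => ?_, fun hT => ?_⟩
    · have hT' : k ∈ T := by
        simpa [Cond.Holds, NExp.eval, h13, h₁.tgt k hk] using hT
      refine (wp_iteOr (b := 200 * (w + 1) + 40) (fun ha => ?_) (fun ha ha' => ?_)).conseq
        fun t m' H => ⟨?_, H.2⟩
      · have ha : A k := by
          refine ha.imp (fun ha => ?_) (fun ha => ?_)
          · simp [Cond.Holds, NExp.eval, e1, h₁.size] at ha
            exact le_antisymm (hdle 1 C) ha
          · simpa [Cond.Holds, NExp.eval, RExp.eval, e1, h13, h₁.fst] using ha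
        refine (wp_iteOr (b := 200 * (w + 1) + 15) (fun hb => ?_) (fun hb hb' => ?_)).conseq
          fun t m' H => ⟨?_, H.2⟩
        · have hb : B k := by
            refine hb.imp (fun ha => ?_) (fun ha => ?_)
            · simp [Cond.Holds, NExp.eval, e0, h₁.size] at ha
              exact le_antisymm (hdle 0 C) ha
            · simpa [Cond.Holds, NExp.eval, RExp.eval, e0, h13, h₁.fst] using ha
          rw [wp_seq]
          refine (wp_coverTest h₁ (fun i hi => by rw [hS.2 6 (by decide), hd i hi]) h13).conseq ?_
          rintro s m₂ ⟨hs, hS₂, hcov⟩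
          have h16 : m₂.nat 16 0 = m₁.nat 16 0 := by rw [hS₂.2 16 (by decide)]
          have h13' : m₂.nat 13 0 = k := by rw [hS₂.2 13 (by decide), h13]
          have hS' := hS.trans hS₂ (by decide)
          simp only [wp_ite, wp_skip, wp_setN, hext]
          simp only [Cond.Holds, NExp.eval, hcov, Cond.cost, NExp.cost]
          refine ⟨fun hv => ⟨by omega, h13', hS'.writeN (by decide) _ _, ?_⟩, fun hv =>
            ⟨by omega, by simpa [nat_writeN] using h13',
              (hS'.writeN (by decide) _ _).writeN (by decide) _ _, ?_⟩⟩
          · have : V k := hv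
            simp [nat_writeN, h16, hc, this]
          · have : ¬ V k := hv
            simp [nat_writeN, hT', ha, hb, this]
        · refine hskip (fun _ _ hB => ?_) _ (by omega)
          exfalso
          rcases hB with hB | hB
          · exact hb (by simp [Cond.Holds, NExp.eval, e0, h₁.size, hB])
          · exact hb' (by simpa [Cond.Holds, NExp.eval, RExp.eval, e0, h13, h₁.fst] using hB)
        · have := H.1
          simp only [Cond.cost, NExp.cost, RExp.cost] at this ⊢
          omega
      · refine hskip (fun _ hA _ => ?_) _ (by omega)
        exfalso
        rcases hA with hA | hA
        · exact ha (by simp [Cond.Holds, NExp.eval, e1, h₁.size, hA])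
        · exact ha' (by simpa [Cond.Holds, NExp.eval, RExp.eval, e1, h13, h₁.fst] using hA)
      · have := H.1
        simp only [Cond.cost, NExp.cost, RExp.cost] at this ⊢
        omega
    · refine (hskip (fun hT' => ?_) 1 le_rfl).conseq fun t m' H => ⟨?_, H.2⟩
      · exact absurd (by simpa [Cond.Holds, NExp.eval, h13, h₁.tgt k hk] using hT') hT
      · have := H.1
        simp only [Cond.cost, NExp.cost] at this ⊢
        omega
  · rintro s m' ⟨hs, ⟨hS, hc⟩, -⟩
    refine ⟨?_, hS, hc.trans ⟨fun H t ht => H t (mem_range.1 (h.sub ht)) ht, fun H t _ => H t⟩⟩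
    simp only [NExp.cost] at hs ⊢
    nlinarith

end
-- The table of shortest paths, layer by layer
/-- From the window `u`, the digit `e` leads to an end or to a window that comes to an end in at most
`r` steps. -/
def Valid (n w : ℕ) (X Y : ℕ → ℝ) (T : Finset ℕ) (r u e : ℕ) : Prop :=
  e ≤ n ∧ Chk n w X Y T (u * (n + 1) + e) ∧
    (e = n ∨ Good n w X Y T r ((u * (n + 1) + e) % (n + 1) ^ w))

/-- The first `r + 1` layers of the table `f` are correct: an entry is positive exactly for the windows
that are `Good`, and then exceeds a digit that leads on by `1`. -/
def Layers (n w : ℕ) (X Y : ℕ → ℝ) (T : Finset ℕ) (r : ℕ) (f : ℕ → ℕ) : Prop :=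
  ∀ s u, s ≤ r → u < (n + 1) ^ w →
    (1 ≤ f (s * (n + 1) ^ w + u) ↔ Good n w X Y T s u) ∧
    ∀ e, f (s * (n + 1) ^ w + u) = e + 1 → ∃ s', s = s' + 1 ∧ Valid n w X Y T s' u e

section
variable {n w : ℕ} {X Y : ℕ → ℝ} {T : Finset ℕ}

theorem good_succ_iff {r u : ℕ} :
    Good n w X Y T (r + 1) u ↔ ∃ e, Valid n w X Y T r u e := by
  simp only [Good, Valid]

theorem append_lt {u e : ℕ} (hu : u < (n + 1) ^ w) (he : e ≤ n) :
    u * (n + 1) + e < (n + 1) ^ (w + 1) := by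
  rw [pow_succ]
  have := Nat.mul_le_mul_right (n + 1) (Nat.succ_le_of_lt hu)
  rw [Nat.succ_mul] at this
  omega

/-- An expression for the number of windows. -/
abbrev size (w : ℕ) : NExp := .get 5 (.lit w)

/-- Enter the digit in the variable `12` for the window in the variable `11` into the table, if it
leads to an end. -/
def tryDigit (w : ℕ) : Cmd :=
  .seq (decode w) (.seq (windowTest w)
    (.ite (.nle (.lit 1) (var 16))
      (iteOr (.nle (var 0) (var 12)) (.nle (.lit 1) (.get 4 (.add (var 17) (.get 7 (.lit w)))))
        (.setN 4 (.add (.add (var 17) (size w)) (var 11)) (.add (var 12) (.lit 1))) .skip) .skip))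

theorem wp_tryDigit {r u e : ℕ} {m : Mem} (hw : 0 < w) (h : Loaded n w X Y T m)
    (hu : u < (n + 1) ^ w) (he : e ≤ n) (h10 : m.nat 10 0 = u * (n + 1) + e)
    (h11 : m.nat 11 0 = u) (h12 : m.nat 12 0 = e) (h17 : m.nat 17 0 = r * (n + 1) ^ w)
    (hL : Layers n w X Y T r (m.nat 4)) :
    Wp (tryDigit w) m fun t m' => t ≤ 700 * (w + 1) * (n + 1) ∧
      Same [4, 6, 7, 8, 13, 14, 15, 16] m m' ∧
      (Valid n w X Y T r u e →
        m'.nat 4 = Function.update (m.nat 4) ((r + 1) * (n + 1) ^ w + u) (e + 1)) ∧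
      (¬ Valid n w X Y T r u e → m'.nat 4 = m.nat 4) := by
  unfold tryDigit
  rw [wp_seq]
  refine (wp_decode h10 (append_lt hu he) h.pow).conseq ?_
  rintro t₁ m₁ ⟨ht₁, hS₁, hd⟩
  rw [wp_seq]
  have h₁ := h.of_same hS₁
  refine (wp_windowTest hw h₁ fun i hi => (hd i hi).1).conseq ?_
  rintro t₂ m₂ ⟨ht₂, hS₂, hc⟩
  have h₂ := h₁.of_same hS₂
  have hS : Same [4, 6, 7, 8, 13, 14, 15, 16] m m₂ :=
    ((Same.refl _ m).trans hS₁ (by decide)).trans hS₂ (by decide)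
  have e4 : m₂.nat 4 = m.nat 4 := by rw [hS₂.2 4 (by decide), hS₁.2 4 (by decide)]
  have e7 : m₂.nat 7 w = (u * (n + 1) + e) % (n + 1) ^ w := by
    rw [hS₂.2 7 (by decide), (hd w le_rfl).2]
  have e11 : m₂.nat 11 0 = u := by rw [hS.2 11 (by decide), h11]
  have e12 : m₂.nat 12 0 = e := by rw [hS.2 12 (by decide), h12]
  have e17 : m₂.nat 17 0 = r * (n + 1) ^ w := by rw [hS.2 17 (by decide), h17]
  have e5 := h₂.pow w le_rfl
  -- Layer `r` is already correct, so one look at it decides whether the shifted window comes to an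
  -- end in at most `r` steps.
  have hlook := (hL r ((u * (n + 1) + e) % (n + 1) ^ w) le_rfl
    (Nat.mod_lt _ (by positivity))).1
  have hb : 200 ≤ 200 * (w + 1) * (n + 1) := by nlinarith [Nat.zero_le (w * n)]
  have hadd : 700 * (w + 1) * (n + 1) = 200 * (w + 1) * (n + 1) + 400 * (w + 1) * (n + 1) +
    100 * (w + 1) * (n + 1) := by ring
  have hb' : 100 ≤ 100 * (w + 1) * (n + 1) := by nlinarith [Nat.zero_le (w * n)]
  rw [wp_ite]
  refine ⟨fun h16 => ?_, fun h16 => ?_⟩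
  · have hchk : Chk n w X Y T (u * (n + 1) + e) := hc.1 h16
    refine (wp_iteOr (b := 30) (Q := fun m' => Same [4, 6, 7, 8, 13, 14, 15, 16] m m' ∧
      (Valid n w X Y T r u e →
        m'.nat 4 = Function.update (m.nat 4) ((r + 1) * (n + 1) ^ w + u) (e + 1)) ∧
      (¬ Valid n w X Y T r u e → m'.nat 4 = m.nat 4)) (fun hg => ?_) (fun hg hg' => ?_)).conseq
      fun t m' H => ⟨?_, H.2⟩
    · have hv : Valid n w X Y T r u e := by
        refine ⟨he, hchk, hg.imp (fun hg => ?_) fun hg => hlook.1 ?_⟩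
        · simp only [Cond.Holds, NExp.eval, h₂.size, e12] at hg
          omega
        · simpa only [Cond.Holds, NExp.eval, e17, e7, e4] using hg
      rw [wp_setN]
      refine ⟨by simp [NExp.cost], hS.writeN (by decide) _ _, fun _ => ?_, fun hv' => absurd hv hv'⟩
      simp only [nat_writeN, NExp.eval, e17, e5, e11, e12, e4, if_pos, Nat.succ_mul]
    · rw [wp_skip]
      refine ⟨by decide, hS, fun hv => ?_, fun _ => e4⟩
      exfalso
      rcases hv.2.2 with hv | hv
      · exact hg (by simp [Cond.Holds, NExp.eval, h₂.size, e12, hv])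
      · exact hg' (by simpa only [Cond.Holds, NExp.eval, e17, e7, e4] using hlook.2 hv)
    · have := H.1
      simp only [Cond.cost, NExp.cost] at this ⊢
      omega
  · rw [wp_skip]
    refine ⟨?_, hS, fun hv => ?_, fun _ => e4⟩
    · simp only [Cond.cost, NExp.cost]
      omega
    · exact absurd (hc.2 hv.2.1) h16

/-- Compute a layer of the table from the layer that begins at the address in the variable `17`. -/
def nextLayer (w : ℕ) : Cmd :=
  .seq (setVar 10 (.lit 0))
    (forN 11 (size w)
      (.seq (.setN 4 (.add (.add (var 17) (size w)) (var 11)) (.lit 0))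
        (forN 12 (.add (var 0) (.lit 1))
          (.seq (tryDigit w) (setVar 10 (.add (var 10) (.lit 1)))))))

/-- The entry `c` of the table is correct for a window in the layer after `r`, if only the digits below
`k` are considered. -/
def Entry (n w : ℕ) (X Y : ℕ → ℝ) (T : Finset ℕ) (r u k c : ℕ) : Prop :=
  (1 ≤ c ↔ ∃ e < k, Valid n w X Y T r u e) ∧ ∀ e, c = e + 1 → Valid n w X Y T r u e

/-- Layers `0, …, r` occupy the cells below `(r + 1) * (n + 1) ^ w`, so work on the next layer
leaves them intact. -/
theorem Layers.congr {r : ℕ} {f g : ℕ → ℕ} (h : Layers n w X Y T r f)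
    (hg : ∀ j < (r + 1) * (n + 1) ^ w, g j = f j) : Layers n w X Y T r g := by
  intro s u hs hu
  rw [hg]
  · exact h s u hs hu
  · have : (s + 1) * (n + 1) ^ w ≤ (r + 1) * (n + 1) ^ w := Nat.mul_le_mul_right _ (by omega)
    rw [Nat.succ_mul] at this
    omega

theorem Layers.succ {r : ℕ} {f : ℕ → ℕ} (h : Layers n w X Y T r f)
    (h' : ∀ u < (n + 1) ^ w, Entry n w X Y T r u (n + 1) (f ((r + 1) * (n + 1) ^ w + u))) :
    Layers n w X Y T (r + 1) f := by
  intro s u hs hu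
  rcases hs.eq_or_lt with rfl | hs
  · obtain ⟨h₁, h₂⟩ := h' u hu
    refine ⟨h₁.trans ?_, fun e he => ⟨r, rfl, h₂ e he⟩⟩
    rw [good_succ_iff]
    exact ⟨fun ⟨e, _, he⟩ => ⟨e, he⟩, fun ⟨e, he⟩ => ⟨e, Nat.lt_succ_of_le he.1, he⟩⟩
  · exact h s u (by omega) hu

/-- With `u` in the outer loop and `e` in the inner one, the codes `u * (n + 1) + e` are consecutive
numbers, so variable `10` only has to be increased by `1`. There are `(n + 1) ^ (w + 1)` codes, each
tested in time `O((w + 1) (n + 1))`. Every entry is reset first, so remains of an earlier search do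
no harm. -/
theorem wp_nextLayer {r : ℕ} {m : Mem} (hw : 0 < w) (h : Loaded n w X Y T m)
    (h17 : m.nat 17 0 = r * (n + 1) ^ w) (hL : Layers n w X Y T r (m.nat 4)) :
    Wp (nextLayer w) m fun t m' => t ≤ 5000 * (w + 1) * (n + 1) ^ (w + 2) ∧
      Same [4, 6, 7, 8, 10, 11, 12, 13, 14, 15, 16] m m' ∧
      Layers n w X Y T (r + 1) (m'.nat 4) ∧
      ∀ j < (r + 1) * (n + 1) ^ w, m'.nat 4 j = m.nat 4 j := by
  unfold nextLayer
  set N := (n + 1) ^ w with hN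
  have hNpos : 1 ≤ N := Nat.one_le_iff_ne_zero.2 (by positivity)
  simp only [wp_seq, wp_setN]
  refine (Wp.forN N ((n + 2) * (700 * (w + 1) * (n + 1) + 30) + 30)
    (fun u m' => Same [4, 6, 7, 8, 10, 11, 12, 13, 14, 15, 16] m m' ∧
      m'.nat 10 0 = u * (n + 1) ∧ (∀ j < (r + 1) * N, m'.nat 4 j = m.nat 4 j) ∧
      ∀ u' < u, Entry n w X Y T r u' (n + 1) (m'.nat 4 ((r + 1) * N + u'))) ?_ ?_ ?_).conseq ?_
  · refine ⟨((Same.refl _ m).writeN (by decide) _ _).writeN (by decide) _ _, ?_, ?_, ?_⟩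
    · simp [nat_writeN, NExp.eval]
    · simp [nat_writeN]
    · simp
  · rintro u m' ⟨hS, -⟩
    simp [NExp.eval, hS.2 5 (by decide), h.pow w le_rfl, hN]
  · rintro u hu m₁ ⟨hS, h10, htab, hent⟩ h11
    have e17 : m₁.nat 17 0 = r * N := by rw [hS.2 17 (by decide), h17]
    have e5 : m₁.nat 5 w = N := by rw [hS.2 5 (by decide), h.pow w le_rfl]
    simp only [wp_seq, wp_setN]
    refine (Wp.forN (n + 1) (700 * (w + 1) * (n + 1) + 10)
      (fun e m' => Same [4, 6, 7, 8, 10, 11, 12, 13, 14, 15, 16] m m' ∧ m'.nat 11 0 = u ∧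
        m'.nat 10 0 = u * (n + 1) + e ∧
        (∀ j, j ≠ (r + 1) * N + u → m'.nat 4 j = m₁.nat 4 j) ∧
        Entry n w X Y T r u e (m'.nat 4 ((r + 1) * N + u))) ?_ ?_ ?_).conseq ?_
    · refine ⟨(hS.writeN (by decide) _ _).writeN (by decide) _ _, ?_, ?_, ?_, ?_⟩
      · simpa [nat_writeN] using h11
      · simpa [nat_writeN] using h10
      · intro j hj
        rw [Nat.succ_mul] at hj
        simp [nat_writeN, NExp.eval, e17, e5, h11, hj]
      · simp [nat_writeN, NExp.eval, e17, e5, h11, Nat.succ_mul, Entry]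
    · rintro e m' ⟨hS', -⟩
      simp [NExp.eval, hS'.2 0 (by decide), h.size]
    · rintro e he m₂ ⟨hS₂, g11, g10, g4, gE⟩ g12
      have h₂ := h.of_same hS₂
      have g17 : m₂.nat 17 0 = r * N := by rw [hS₂.2 17 (by decide), h17]
      have gL : Layers n w X Y T r (m₂.nat 4) := hL.congr fun j hj => by
        rw [← hN] at hj
        rw [g4 j (by omega), htab j hj]
      simp only [wp_seq, wp_setN]
      refine (wp_tryDigit hw h₂ hu (by omega) g10 g11 g12 g17 gL).conseq ?_
      rintro t m₃ ⟨ht, hS₃, hv, hv'⟩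
      rw [← hN] at hv
      have hS₃' := hS₂.trans hS₃ (by decide)
      refine ⟨?_, ?_, (hS₃'.writeN (by decide) _ _).writeN (by decide) _ _, ?_, ?_, ?_, ?_⟩
      · simp only [NExp.cost]; omega
      · simpa [nat_writeN, hS₃.2 12 (by decide)] using g12
      · simpa [nat_writeN, hS₃.2 11 (by decide)] using g11
      · simp [nat_writeN, NExp.eval, hS₃.2 10 (by decide), g10]; ring
      · intro j hj
        rw [← g4 j hj]
        by_cases hV : Valid n w X Y T r u e
        · simp [nat_writeN, hv hV, hj]
        · simp [nat_writeN, hv' hV]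
      -- A valid digit overwrites the entry and the last one stays; any valid digit would do.
      · by_cases hV : Valid n w X Y T r u e
        · simp only [nat_writeN, hv hV]
          simp only [Entry, Nat.reduceEqDiff, if_false, Function.update_self]
          exact ⟨⟨fun _ => ⟨e, by omega, hV⟩, fun _ => by omega⟩, fun e' he' => by
            obtain rfl : e = e' := by omega
            exact hV⟩
        · simp only [nat_writeN, hv' hV]
          simp only [Nat.reduceEqDiff, if_false]
          refine ⟨gE.1.trans ⟨fun ⟨e', h₁, h₂⟩ => ⟨e', by omega, h₂⟩, fun ⟨e', h₁, h₂⟩ => ?_⟩, gE.2⟩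
          rcases (Nat.lt_succ_iff.1 h₁).eq_or_lt with rfl | h₁
          · exact absurd h₂ hV
          · exact ⟨e', h₁, h₂⟩
    · rintro t m' ⟨ht, ⟨hS', g11, g10, g4, gE⟩, -⟩
      refine ⟨?_, g11, hS'.writeN (by decide) _ _, ?_, ?_, ?_⟩
      · simp only [NExp.cost] at ht ⊢
        nlinarith
      · simp [nat_writeN, g10]; ring
      · intro j hj
        simp only [nat_writeN, Nat.reduceEqDiff, if_false]
        rw [g4 j (by omega), htab j hj]
      · intro u' hu'
        simp only [nat_writeN, Nat.reduceEqDiff, if_false]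
        rcases (Nat.lt_succ_iff.1 hu').eq_or_lt with rfl | hu'
        · exact gE
        · rw [g4 _ (by omega)]
          exact hent u' hu'
  · rintro t m' ⟨ht, ⟨hS, h10, htab, hent⟩, -⟩
    refine ⟨?_, hS, (hL.congr htab).succ hent, htab⟩
    simp only [NExp.cost] at ht ⊢
    have hpow : (n + 1) ^ (w + 2) = N * (n + 1) ^ 2 := by rw [pow_add]
    rw [hpow]
    have hB : 1 ≤ n + 1 := by omega
    have hK : (n + 2) * (700 * (w + 1) * (n + 1) + 30) + 30 + 2 + 12 + 4 ≤
        2000 * ((w + 1) * (n + 1) ^ 2) := by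
      nlinarith [Nat.zero_le (w * n), Nat.zero_le (w * n * n), Nat.zero_le (n * n)]
    have := Nat.mul_le_mul (show N + 1 ≤ 2 * N by omega) hK
    have h1 : 1 ≤ N * ((w + 1) * (n + 1) ^ 2) := Nat.one_le_iff_ne_zero.2 (by positivity)
    have e1 : 2 * N * (2000 * ((w + 1) * (n + 1) ^ 2)) = 4000 * (N * ((w + 1) * (n + 1) ^ 2)) := by
      ring
    have e2 : 5000 * (w + 1) * (N * (n + 1) ^ 2) = 5000 * (N * ((w + 1) * (n + 1) ^ 2)) := by ring
    rw [e1] at this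
    rw [e2]
    nlinarith

end
-- Finding the first good layer and reading off a path
section
variable {n w : ℕ} {X Y : ℕ → ℝ} {T : Finset ℕ}

/-- Compute layers of the table until one contains the empty window. -/
def search (w : ℕ) : Cmd :=
  .seq (setVar 17 (.lit 0))
    (.loop (.nle (.get 4 (.add (var 17) (.sub (size w) (.lit 1)))) (.lit 0))
      (.seq (nextLayer w) (setVar 17 (.add (var 17) (size w)))))

/-- The search stops at the least `r` for which the empty window is good, so a bound `k` on that
number need not be known to the program; it enters only the time bound. Layer `0` stays zero, which
permits another search in the same store. -/
theorem wp_search {k : ℕ} {m : Mem} (hw : 0 < w) (h : Loaded n w X Y T m)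
    (h0 : ∀ j < (n + 1) ^ w, m.nat 4 j = 0) (hk : Good n w X Y T k ((n + 1) ^ w - 1)) :
    Wp (search w) m fun t m' => t ≤ (k + 1) * (6000 * (w + 1) * (n + 1) ^ (w + 2)) ∧
      Same [4, 6, 7, 8, 10, 11, 12, 13, 14, 15, 16, 17] m m' ∧
      (∀ j < (n + 1) ^ w, m'.nat 4 j = 0) ∧
      ∃ r ≤ k, m'.nat 17 0 = r * (n + 1) ^ w ∧ Layers n w X Y T r (m'.nat 4) ∧
        Good n w X Y T r ((n + 1) ^ w - 1) := by
  classical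
  unfold search
  set N := (n + 1) ^ w with hN
  have hNpos : 0 < N := by positivity
  have hex : ∃ k, Good n w X Y T k (N - 1) := ⟨k, hk⟩
  simp only [wp_seq, wp_setN]
  refine (Wp.loop (Nat.find hex) (5000 * (w + 1) * (n + 1) ^ (w + 2) + 20)
    (fun r m' => Same [4, 6, 7, 8, 10, 11, 12, 13, 14, 15, 16, 17] m m' ∧ m'.nat 17 0 = r * N ∧
      Layers n w X Y T r (m'.nat 4) ∧ ∀ j < N, m'.nat 4 j = 0) ?_ ?_ ?_).conseq ?_
  · refine ⟨(Same.refl _ m).writeN (by decide) _ _, by simp [nat_writeN, NExp.eval], ?_, ?_⟩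
    -- In layer `0` no window is good, so the zeros of the store are already the correct entries.
    · intro s u hs hu
      obtain rfl : s = 0 := by omega
      simp [nat_writeN, h0 u (hN ▸ hu), Good]
    · simpa [nat_writeN] using h0
  · rintro r hr m₁ ⟨hS, h17, hL, hz⟩
    have e5 : m₁.nat 5 w = N := by rw [hS.2 5 (by decide), h.pow w le_rfl]
    refine ⟨?_, ?_⟩
    · simp only [Cond.Holds, NExp.eval, h17, e5]
      have := (hL r (N - 1) le_rfl (by omega)).1.not.2 (Nat.find_min hex hr)
      rw [← hN] at this
      omega
    · simp only [wp_seq, wp_setN]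
      refine (wp_nextLayer hw (h.of_same hS) h17 hL).conseq ?_
      rintro t m₂ ⟨ht, hS₂, hL₂, htab⟩
      refine ⟨?_, (hS.trans hS₂ (by decide)).writeN (by decide) _ _, ?_, ?_, ?_⟩
      · simp only [NExp.cost]; omega
      · simp [nat_writeN, NExp.eval, hS₂.2 17 (by decide), hS₂.2 5 (by decide), e5, h17]
        ring
      · simpa [nat_writeN] using hL₂
      · intro j hj
        simp only [nat_writeN, Nat.reduceEqDiff, if_false]
        rw [htab j (by rw [← hN]; nlinarith), hz j hj]
  · rintro m₁ ⟨hS, h17, hL, hz⟩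
    have e5 : m₁.nat 5 w = N := by rw [hS.2 5 (by decide), h.pow w le_rfl]
    simp only [Cond.Holds, NExp.eval, h17, e5]
    have := (hL _ (N - 1) le_rfl (by omega)).1.2 (Nat.find_spec hex)
    rw [← hN] at this
    omega
  · rintro t m' ⟨ht, hS, h17, hL, hz⟩
    have hle : Nat.find hex ≤ k := Nat.find_min' hex hk
    refine ⟨?_, hS, hz, Nat.find hex, hle, h17, hL, Nat.find_spec hex⟩
    have hP : 1 ≤ (w + 1) * (n + 1) ^ (w + 2) := Nat.one_le_iff_ne_zero.2 (by positivity)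
    simp only [Cond.cost, NExp.cost, mul_assoc] at ht ⊢
    have := Nat.mul_le_mul hle (show 1 + (1 + (1 + (1 + (1 + 1) + (1 + (1 + 1) + 1))) + 1) +
      (5000 * ((w + 1) * (n + 1) ^ (w + 2)) + 20) ≤ 6000 * ((w + 1) * (n + 1) ^ (w + 2)) by omega)
    rw [Nat.succ_mul]
    omega

/-- Mark the digit in the variable `12` as chosen, and go on to the next window. -/
def advance (w : ℕ) : Cmd :=
  .seq (.setN 1 (var 12) (.lit 1)) (.seq (setVar 10 (var 12))
    (.seq (forN 9 (.add (var 0) (.lit 1)) (setVar 10 (.add (var 10) (var 11))))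
      (.seq (.loop (.nle (size w) (var 10)) (setVar 10 (.sub (var 10) (size w))))
        (.seq (setVar 11 (var 10)) (.seq (setVar 17 (.sub (var 17) (size w)))
          (setVar 12 (.sub (.get 4 (.add (var 17) (var 11))) (.lit 1))))))))

/-- The code `u * (n + 1) + e` comes from `n + 1` additions of `u` to `e`, and its remainder modulo
`(n + 1) ^ w` from repeated subtraction. -/
theorem wp_advance {r u e : ℕ} {m : Mem} (hn : m.nat 0 0 = n)
    (hp : m.nat 5 w = (n + 1) ^ w) (hu : u < (n + 1) ^ w) (he : e ≤ n) (h11 : m.nat 11 0 = u)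
    (h12 : m.nat 12 0 = e) (h17 : m.nat 17 0 = (r + 1) * (n + 1) ^ w) :
    Wp (advance w) m fun t m' => t ≤ 200 * (n + 1) ∧ Same [1, 9, 10, 11, 12, 17] m m' ∧
      m'.nat 11 0 = (u * (n + 1) + e) % (n + 1) ^ w ∧ m'.nat 17 0 = r * (n + 1) ^ w ∧
      m'.nat 12 0 = m.nat 4 (r * (n + 1) ^ w + (u * (n + 1) + e) % (n + 1) ^ w) - 1 ∧
      m'.nat 1 = Function.update (m.nat 1) e 1 := by
  unfold advance
  set N := (n + 1) ^ w with hN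
  have hNpos : 0 < N := by positivity
  set C := u * (n + 1) + e with hC
  simp only [wp_seq, wp_setN]
  refine (Wp.forN (n + 1) 10 (fun k m' => Same [1, 9, 10] m m' ∧ m'.nat 10 0 = k * u + e ∧
    m'.nat 1 = Function.update (m.nat 1) e 1) ?_ ?_ ?_).conseq ?_
  · refine ⟨(((Same.refl _ m).writeN (by decide) _ _).writeN (by decide) _ _).writeN
      (by decide) _ _, ?_, ?_⟩
    · simp [nat_writeN, NExp.eval, h12]
    · simp [nat_writeN, NExp.eval, h12]
  · rintro k m' ⟨hS, -⟩
    simp [NExp.eval, hS.2 0 (by decide), hn]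
  · rintro k hk m₁ ⟨hS, h10, h1⟩ h9
    have e11 : m₁.nat 11 0 = u := by rw [hS.2 11 (by decide), h11]
    rw [wp_setN]
    refine ⟨by simp [NExp.cost], by simpa [nat_writeN] using h9,
      (hS.writeN (by decide) _ _).writeN (by decide) _ _, ?_, by simpa [nat_writeN] using h1⟩
    simp [nat_writeN, NExp.eval, h10, e11]
    ring
  · rintro t₁ m₁ ⟨ht₁, ⟨hS₁, h10, h1⟩, -⟩
    have hdm := Nat.div_add_mod C N
    -- The quotient is the digit that drops out of the window, so at most `n` subtractions are
    -- needed.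
    have hq : C / N ≤ n := by
      rw [← Nat.lt_succ_iff, Nat.div_lt_iff_lt_mul hNpos, mul_comm, ← pow_succ]
      exact append_lt hu he
    refine (Wp.loop (C / N) 10 (fun j m' => Same [10] m₁ m' ∧ m'.nat 10 0 + j * N = C)
      ?_ ?_ ?_).conseq ?_
    · exact ⟨Same.refl _ _, by rw [h10, hC]; ring⟩
    · rintro j hj m₂ ⟨hS₂, g10⟩
      have e5 : m₂.nat 5 w = N := by rw [hS₂.2 5 (by decide), hS₁.2 5 (by decide), hp]
      have hle : N ≤ m₂.nat 10 0 := by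
        generalize C % N = ρ at hdm
        have h₂ := Nat.mul_le_mul_left N (Nat.succ_le_of_lt hj)
        rw [Nat.mul_succ, Nat.mul_comm _ j] at h₂
        omega
      refine ⟨by simpa [Cond.Holds, NExp.eval, e5] using hle, ?_⟩
      rw [wp_setN]
      refine ⟨by simp [NExp.cost], hS₂.writeN (by decide) _ _, ?_⟩
      simp [nat_writeN, NExp.eval, e5, Nat.succ_mul]
      omega
    · rintro m₂ ⟨hS₂, g10⟩
      have e5 : m₂.nat 5 w = N := by rw [hS₂.2 5 (by decide), hS₁.2 5 (by decide), hp]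
      have h₂ := Nat.mod_lt C hNpos
      rw [Nat.mul_comm] at hdm
      simp only [Cond.Holds, NExp.eval, e5]
      omega
    · rintro t₂ m₂ ⟨ht₂, hS₂, g10⟩
      have hS := ((Same.refl [1, 9, 10, 11, 12, 17] m).trans hS₁ (by decide)).trans hS₂ (by decide)
      have e5 : m₂.nat 5 w = N := by rw [hS.2 5 (by decide), hp]
      have e4 : m₂.nat 4 = m.nat 4 := hS.2 4 (by decide)
      have e1 : m₂.nat 1 = m₁.nat 1 := hS₂.2 1 (by decide)
      have e17 : m₂.nat 17 0 = (r + 1) * N := by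
        rw [hS₂.2 17 (by decide), hS₁.2 17 (by decide), h17]
      have e10 : m₂.nat 10 0 = C % N := by
        rw [Nat.mul_comm] at hdm
        omega
      have esub : (r + 1) * N - N = r * N := by rw [Nat.succ_mul]; omega
      refine ⟨?_, ((hS.writeN (by decide) _ _).writeN (by decide) _ _).writeN (by decide) _ _,
        ?_, ?_, ?_, ?_⟩
      · have h₃ := Nat.mul_le_mul_right 17 hq
        simp only [NExp.cost, Cond.cost] at ht₁ ht₂ ⊢
        omega
      · simp [nat_writeN, NExp.eval, e10]
      · simp [nat_writeN, NExp.eval, e17, e5, esub]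
      · simp [nat_writeN, NExp.eval, e17, e5, esub, e10, e4]
      · simp [nat_writeN, e1, h1]

/-- Follow the entries of the table from the empty window on, and mark the chosen points. -/
def walk (w : ℕ) : Cmd :=
  .seq (setVar 11 (.sub (size w) (.lit 1)))
    (.seq (setVar 12 (.sub (.get 4 (.add (var 17) (var 11))) (.lit 1)))
      (.loop (lt (var 12) (var 0)) (advance w)))

/-- Induction on the layer: each step goes down one layer and adds at most one point to `O`. In `#O'
+ 1 ≤ #O + r` the summand `1` is the last step, whose digit `n` adds no point. The flags `out` set
before the walk are kept. -/
theorem wp_walk_loop {f : ℕ → ℕ} (hw : 0 < w) {r : ℕ} (hL : Layers n w X Y T r f) {out : ℕ → ℕ}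
    {m₀ : Mem} (h : Loaded n w X Y T m₀) (h4 : m₀.nat 4 = f) {u : ℕ} {m : Mem} {O : Finset ℕ}
    (hS : Same [1, 9, 10, 11, 12, 17] m₀ m) (hu : u < (n + 1) ^ w)
    (hg : Good n w X Y T r u) (h11 : m.nat 11 0 = u)
    (h12 : m.nat 12 0 = f (r * (n + 1) ^ w + u) - 1) (h17 : m.nat 17 0 = r * (n + 1) ^ w)
    (hO : Partial n w X Y T u O) (hOn : O ⊆ range n)
    (hout : ∀ i, m.nat 1 i = 1 ↔ out i = 1 ∨ i ∈ O) :
    Wp (.loop (lt (var 12) (var 0)) (advance w)) m fun t m' => t ≤ (r + 1) * (300 * (n + 1)) ∧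
      Same [1, 9, 10, 11, 12, 17] m₀ m' ∧ ∃ O' ⊆ range n, Dom X Y O' T ∧ #O' + 1 ≤ #O + r ∧
        ∀ i, m'.nat 1 i = 1 ↔ out i = 1 ∨ i ∈ O' := by
  classical
  induction r generalizing u m O with
  | zero => exact absurd hg (by simp [Good])
  | succ r ih =>
    obtain ⟨hl₁, hl₂⟩ := hL (r + 1) u le_rfl hu
    -- The entry of a good window is positive, so the truncated subtraction that decodes its digit
    -- is exact.
    obtain ⟨e, he⟩ : ∃ e, f ((r + 1) * (n + 1) ^ w + u) = e + 1 :=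
      ⟨_, (Nat.succ_pred_eq_of_pos (hl₁.2 hg)).symm⟩
    obtain ⟨r', hr', hv⟩ := hl₂ e he
    obtain rfl : r = r' := by omega
    rw [he, Nat.add_sub_cancel] at h12
    have e0 : m.nat 0 0 = n := by rw [hS.2 0 (by decide), h.size]
    refine wp_loop_unfold (fun hc => ?_) (fun hc => ?_)
    · have hlt : e < n := by simpa [Cond.Holds, NExp.eval, h12, e0] using hc
      have e5 : m.nat 5 w = (n + 1) ^ w := by rw [hS.2 5 (by decide), h.pow w le_rfl]
      refine (wp_advance e0 e5 hu hlt.le h11 h12 h17).conseq ?_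
      rintro s m₁ ⟨hs, hS₁, g11, g17, g12, g1⟩
      rw [hS.2 4 (by decide), h4] at g12
      refine (ih (fun s u hs hu => hL s u (by omega) hu) (hS.trans hS₁ (by decide))
        (Nat.mod_lt _ (by positivity)) (hv.2.2.resolve_left hlt.ne) g11 g12 g17
        (hO.insert hw hlt hv.2.1) (insert_subset (mem_range.2 hlt) hOn) ?_).conseq ?_
      · intro i
        rw [g1, Function.update_apply, mem_insert]
        by_cases hi : i = e
        · simp [hi]
        · simp [hi, hout]
      · rintro t m₂ ⟨ht, hS₂, O', h₁, h₂, h₃, h₄⟩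
        refine ⟨?_, hS₂, O', h₁, h₂, ?_, h₄⟩
        · simp only [Cond.cost, NExp.cost]
          rw [Nat.succ_mul]
          omega
        · have := card_insert_le e O
          omega
    · have hen : e = n := by
        have : n ≤ e := by simpa [Cond.Holds, NExp.eval, h12, e0] using hc
        exact le_antisymm hv.1 this
      refine ⟨?_, hS, O, hOn, hO.last (hen ▸ hv.2.1), by omega, hout⟩
      simp only [Cond.cost, NExp.cost]
      nlinarith [Nat.zero_le (r * n)]

/-- Add a minimum cover of the targets to the output. -/
def solve (w : ℕ) : Cmd := .seq (powers w) (.seq (search w) (walk w))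

/-- The minimum cover `D` is unknown to the program: it only shows that a path of `#D + 1` steps
exists. The path found is no longer, so its points number at most `#D`. The first layer is again
zero afterwards, and the output is only extended, so that the routine can be called for strip after
strip. -/
theorem wp_solve {m : Mem} {D : Finset ℕ} (hw : 0 < w) (hn : m.nat 0 0 = n) (hX : m.real 0 = X)
    (hY : m.real 1 = Y) (hT : T ⊆ range n) (htgt : ∀ t < n, 1 ≤ m.nat 2 t ↔ t ∈ T)
    (hz : ∀ j < (n + 1) ^ w, m.nat 4 j = 0) (hD : MinDom n X Y D T)
    (hwin : ∀ c : ℝ, #(D.filter fun d => |X d - c| ≤ 1) ≤ w) :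
    Wp (solve w) m fun t m' => t ≤ (#D + 2) * (7000 * (w + 1) * (n + 1) ^ (w + 2)) ∧
      Same [1, 4, 5, 6, 7, 8, 9, 10, 11, 12, 13, 14, 15, 16, 17] m m' ∧
      (∀ j < (n + 1) ^ w, m'.nat 4 j = 0) ∧
      ∃ O ⊆ range n, Dom X Y O T ∧ #O ≤ #D ∧ ∀ i, m'.nat 1 i = 1 ↔ m.nat 1 i = 1 ∨ i ∈ O := by
  unfold solve
  rw [wp_seq]
  refine (wp_powers w hn).conseq ?_
  rintro t₁ m₁ ⟨ht₁, hS₁, hp⟩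
  have h₁ : Loaded n w X Y T m₁ :=
    ⟨by rw [hS₁.2 0 (by decide), hn], by rw [hS₁.1, hX], by rw [hS₁.1, hY], hT,
      by rw [hS₁.2 2 (by decide)]; exact htgt, hp⟩
  rw [wp_seq]
  refine (wp_search hw h₁ (by rw [hS₁.2 4 (by decide)]; exact hz) (hD.good hw hwin)).conseq ?_
  rintro t₂ m₂ ⟨ht₂, hS₂, hz₂, r, hr, h17, hL, hg⟩
  have h₂ := h₁.of_same hS₂
  have e5 := h₂.pow w le_rfl
  have e1 : m₂.nat 1 = m.nat 1 := by rw [hS₂.2 1 (by decide), hS₁.2 1 (by decide)]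
  unfold walk
  simp only [wp_seq, wp_setN]
  refine (wp_walk_loop hw hL (out := m.nat 1) h₂ rfl (O := ∅) (u := (n + 1) ^ w - 1)
    (((Same.refl _ m₂).writeN (by decide) _ _).writeN (by decide) _ _)
    (Nat.sub_lt (by positivity) Nat.one_pos) hg ?_ ?_ ?_ (partial_empty hw) (empty_subset _)
    ?_).conseq ?_
  · simp [nat_writeN, NExp.eval, e5]
  · simp [nat_writeN, NExp.eval, e5, h17]
  · simp [nat_writeN, h17]
  · intro i
    simp [nat_writeN, e1]
  · rintro t₃ m₃ ⟨ht₃, hS₃, O, h₃, h₄, h₅, h₆⟩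
    refine ⟨?_, ((((Same.refl _ m).trans hS₁ (by decide)).trans hS₂ (by decide)).trans hS₃
      (by decide)), by rw [hS₃.2 4 (by decide)]; exact hz₂, O, h₃, h₄, ?_, h₆⟩
    · have hB : n + 1 ≤ (n + 1) ^ (w + 2) := Nat.le_self_pow (by omega) _
      have hP : 1 ≤ (n + 1) ^ (w + 2) := Nat.one_le_iff_ne_zero.2 (by positivity)
      have hQ : (n + 1) ^ (w + 2) ≤ (w + 1) * (n + 1) ^ (w + 2) := Nat.le_mul_of_pos_left _ (by omega)
      have hR : (w + 1) * (n + 1) ≤ (w + 1) * (n + 1) ^ (w + 2) := Nat.mul_le_mul_left _ hB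
      have hr' := Nat.mul_le_mul_right (300 * (n + 1)) (Nat.succ_le_succ hr)
      simp only [NExp.cost, mul_assoc, Nat.succ_eq_add_one] at ht₁ ht₂ ht₃ hr' ⊢
      generalize (w + 1) * (n + 1) ^ (w + 2) = Z at *
      nlinarith
    · simp at h₅
      omega

end
end GeomMDS

/-! # Hexagonal cells and the number of disks in a window -/

namespace GeomMDS

open Finset RealRAM

/-- The point `(x, y)` lies in the cell with centre `(u, v)`. -/
def InHex (u v x y : ℝ) : Prop := |x - u| ≤ √3 / 4 ∧ |x - u| / √3 + |y - v| ≤ 1 / 2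

/-- Put `x - u = √3 * a`. For two points of the cell with `s = |b - a|`, the definition gives `s ≤
1/2` and a difference of ordinates of at most `1 - s`. The squared distance is at most `3 s² + (1 -
s)² = 1 - 2 s (1 - 2 s) ≤ 1`. -/
theorem InHex.near {X Y : ℕ → ℝ} {u v : ℝ} {t t' : ℕ} (h : InHex u v (X t) (Y t))
    (h' : InHex u v (X t') (Y t')) : Near X Y t t' := by
  have h3 : (0 : ℝ) < √3 := by positivity
  have hsq : √3 * √3 = 3 := Real.mul_self_sqrt (by norm_num)
  have key : ∀ x y, InHex u v x y → ∃ a, x - u = √3 * a ∧ |a| ≤ 1 / 4 ∧ |a| + |y - v| ≤ 1 / 2 := by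
    rintro x y ⟨h₁, h₂⟩
    refine ⟨(x - u) / √3, by field_simp, ?_, ?_⟩
    · rw [abs_div, abs_of_pos h3, div_le_iff₀ h3]; linarith
    · rwa [abs_div, abs_of_pos h3]
  obtain ⟨a, ha, ha₁, ha₂⟩ := key _ _ h
  obtain ⟨b, hb, hb₁, hb₂⟩ := key _ _ h'
  have hx : X t' - X t = √3 * (b - a) := by linear_combination hb - ha
  have hA : |b - a| ≤ 1 / 2 := (abs_sub _ _).trans (by linarith)
  have hY : |Y t' - Y t| ≤ 1 - |b - a| := by
    have h₁ : |b - a| ≤ |b| + |a| := abs_sub _ _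
    have h₂ : |Y t' - Y t| ≤ |Y t' - v| + |Y t - v| := by
      rw [show Y t' - Y t = (Y t' - v) - (Y t - v) by ring]; exact abs_sub _ _
    linarith
  have hY2 : (Y t' - Y t) ^ 2 ≤ (1 - |b - a|) ^ 2 := by
    rw [← sq_abs (Y t' - Y t)]
    exact pow_le_pow_left₀ (abs_nonneg _) hY 2
  unfold Near
  rw [hx, mul_pow, sq √3, hsq, ← sq_abs (b - a)]
  nlinarith [abs_nonneg (b - a)]

theorem card_le_six {s : Finset ℕ} (h : ∀ a ∈ s, ∀ b ∈ s, a ≤ b + 5) : #s ≤ 6 := by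
  rcases s.eq_empty_or_nonempty with rfl | hs
  · simp
  · have : s ⊆ Icc (s.min' hs) (s.min' hs + 5) := fun a ha =>
      mem_Icc.2 ⟨min'_le _ _ ha, h a ha _ (min'_mem _ _)⟩
    have := card_le_card this
    rw [Nat.card_Icc] at this
    omega

/-! ### How many disks of a minimum cover lie in a slab -/

/-- The abscissa of the centre of a cell of a duper-cell. -/
noncomputable def cellX (a₀ : ℝ) (c : Fin 3 × Fin 10) : ℝ :=
  a₀ + √3 / 2 * ((c.2 : ℝ) + if c.1 = 1 then 1 / 2 else 0)

/-- The ordinate of the centre of a cell of a duper-cell. -/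
noncomputable def cellY (a₁ : ℝ) (c : Fin 3 × Fin 10) : ℝ := a₁ + 3 / 4 * (c.1 : ℝ)

/-- At most `18` cells of a duper-cell meet a vertical slab of width `4`. -/
theorem card_cells_slab (a₀ c : ℝ) :
    #(univ.filter fun z : Fin 3 × Fin 10 => |cellX a₀ z - c| ≤ 2 + √3 / 4) ≤ 18 := by
  have h3 : (1.7 : ℝ) < √3 := Real.lt_sqrt_of_sq_lt (by norm_num)
  set J := univ.filter fun z : Fin 3 × Fin 10 => |cellX a₀ z - c| ≤ 2 + √3 / 4 with hJ
  have h := card_le_mul_card_image (f := Prod.fst) J 6 fun i _ => by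
    rw [← card_image_of_injOn (f := fun z : Fin 3 × Fin 10 => (z.2 : ℕ))]
    · refine card_le_six ?_
      simp only [mem_image, mem_filter, hJ, mem_univ, true_and]
      rintro _ ⟨⟨i', j⟩, ⟨h₁, rfl⟩, rfl⟩ _ ⟨⟨i'', j'⟩, ⟨h₂, hi⟩, rfl⟩
      simp only at hi
      subst hi
      simp only [cellX] at h₁ h₂ ⊢
      -- Cells of a row that are six places apart have centres at distance at least `3√3`, which
      -- exceeds `4 + √3 / 2` because `√3 > 1.6`. So each of the three rows contributes at most six
      -- cells.
      by_contra! hlt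
      have hlt' : (j' : ℝ) + 6 ≤ (j : ℝ) := by exact_mod_cast hlt
      have h₁' := (abs_le.1 h₁).2
      have h₂' := (abs_le.1 h₂).1
      nlinarith
    · rintro ⟨i', j⟩ h₁ ⟨i'', j'⟩ h₂ h
      simp only [coe_filter, Set.mem_ofPred_eq] at h₁ h₂ h
      exact Prod.ext (h₁.2.trans h₂.2.symm) (Fin.ext h)
  have h' : #(J.image Prod.fst) ≤ 3 := (card_le_univ _).trans (by simp)
  omega

section
variable {n : ℕ} {X Y : ℕ → ℝ} {T D : Finset ℕ}

theorem exists_cell_class {a₀ a₁ : ℝ}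
    (hcell : ∀ t ∈ T, ∃ z : Fin 3 × Fin 10, InHex (cellX a₀ z) (cellY a₁ z) (X t) (Y t)) :
    ∃ cls : ℕ → Fin 3 × Fin 10,
      ∀ t ∈ T, InHex (cellX a₀ (cls t)) (cellY a₁ (cls t)) (X t) (Y t) := by
  choose! cls h using hcell
  exact ⟨cls, h⟩

theorem MinDom.card_le_of_duperCell (hD : MinDom n X Y D T) (hT : T ⊆ range n) {a₀ a₁ : ℝ}
    (hcell : ∀ t ∈ T, ∃ z : Fin 3 × Fin 10, InHex (cellX a₀ z) (cellY a₁ z) (X t) (Y t)) :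
    #D ≤ 30 := by
  obtain ⟨cls, hc⟩ := exists_cell_class hcell
  refine (hD.card_le_of_classes hT subset_rfl (U := fun _ => True) (fun _ _ _ _ _ => trivial)
    univ cls (fun _ _ _ => mem_univ _) fun t ht t' ht' _ _ h => ?_).trans (by simp)
  have := hc t ht
  rw [h] at this
  exact this.near (hc t' ht')

theorem abs_sub_le_two {c : ℝ} {d t : ℕ} (hd : |X d - c| ≤ 1) (h : Near X Y d t) :
    |X t - c| ≤ 2 := by
  have h₁ := h.abs_le
  rw [abs_le] at *
  constructor <;> linarith

/-- Centres within `1` of `c` cover only targets within `2` of `c`. The cells that contain such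
targets have centres within `2 + √3 / 4` of `c`, and these cells are the classes for the exchange.
-/
theorem MinDom.card_window_of_duperCell (hD : MinDom n X Y D T) (hT : T ⊆ range n) {a₀ a₁ : ℝ}
    (hcell : ∀ t ∈ T, ∃ z : Fin 3 × Fin 10, InHex (cellX a₀ z) (cellY a₁ z) (X t) (Y t)) (c : ℝ) :
    #(D.filter fun d => |X d - c| ≤ 1) ≤ 18 := by
  obtain ⟨cls, hc⟩ := exists_cell_class hcell
  refine (hD.card_le_of_classes hT (filter_subset _ _) (U := fun t => |X t - c| ≤ 2)
    (fun t _ d hd h => abs_sub_le_two (mem_filter.1 hd).2 h) _ cls (fun t ht hU => ?_)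
    fun t ht t' ht' _ _ h => ?_).trans (card_cells_slab a₀ c)
  · rw [mem_filter]
    refine ⟨mem_univ _, ?_⟩
    have := (hc t ht).1
    rw [abs_le] at *
    constructor <;> linarith
  · have := hc t ht
    rw [h] at this
    exact this.near (hc t' ht')

/-- Sixteen cells of a hexagonal partition cover a rectangle of width `4` and height `2`. -/
theorem exists_hex_of_rectangle {x y : ℝ} (hx0 : 0 ≤ x) (hx4 : x ≤ 4) (hy0 : 0 ≤ y) (hy2 : y ≤ 2) :
    ∃ z ∈ (range 3 ×ˢ range 11).filter fun z : ℕ × ℕ => (z.1 + z.2) % 2 = 1,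
      InHex (√3 / 4 * z.2) (1 / 4 + 3 / 4 * z.1) x y := by
  have h3 : (1.7 : ℝ) < √3 := Real.lt_sqrt_of_sq_lt (by norm_num)
  have h3' : (0 : ℝ) < √3 := by linarith
  -- Column lines stand at the multiples of `√3 / 4`, half the width of a cell; `x` lies between the
  -- lines `k` and `k + 1`. As `10 * √3 / 4 > 4`, the lines `0, …, 10` suffice.
  obtain ⟨k, hk₁, hk₂⟩ : ∃ k : ℕ, √3 / 4 * k ≤ x ∧ x < √3 / 4 * (k + 1) := by
    refine ⟨⌊x / (√3 / 4)⌋₊, ?_, ?_⟩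
    · have := Nat.floor_le (a := x / (√3 / 4)) (by positivity)
      rw [le_div_iff₀ (by positivity)] at this
      linarith
    · have := Nat.lt_floor_add_one (x / (√3 / 4))
      rw [div_lt_iff₀ (by positivity)] at this
      linarith
  have hk : k ≤ 9 := by
    by_contra! h
    have : (10 : ℝ) ≤ k := by exact_mod_cast h
    nlinarith
  -- Of the two neighbouring lines, the odd one `l` carries centres of the outer rows and the even
  -- one `l'` those of the middle row; the distances of `x` from them add up to `√3 / 4`.
  obtain ⟨l, l', hl, hl', hlk, hlk', hsum⟩ : ∃ l l' : ℕ, l % 2 = 1 ∧ l' % 2 = 0 ∧ l ≤ 10 ∧ l' ≤ 10 ∧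
      |x - √3 / 4 * l| + |x - √3 / 4 * l'| = √3 / 4 := by
    have e₁ : |x - √3 / 4 * k| = x - √3 / 4 * k := abs_of_nonneg (by linarith)
    have e₂ : |x - √3 / 4 * ((k + 1 : ℕ) : ℝ)| = √3 / 4 * (k + 1) - x := by
      push_cast
      rw [abs_of_nonpos (by linarith)]
      ring
    rcases Nat.mod_two_eq_zero_or_one k with h | h
    · exact ⟨k + 1, k, by omega, h, by omega, by omega, by rw [e₁, e₂]; ring⟩
    · exact ⟨k, k + 1, h, by omega, by omega, by omega, by rw [e₁, e₂]; ring⟩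
  have hd : |x - √3 / 4 * l| / √3 + |x - √3 / 4 * l'| / √3 = 1 / 4 := by
    rw [← add_div, hsum]; field_simp
  have hn : 0 ≤ |x - √3 / 4 * l| / √3 := by positivity
  have hn' : 0 ≤ |x - √3 / 4 * l'| / √3 := by positivity
  have hb : |x - √3 / 4 * l| ≤ √3 / 4 := by linarith [abs_nonneg (x - √3 / 4 * l')]
  have hb' : |x - √3 / 4 * l'| ≤ √3 / 4 := by linarith [abs_nonneg (x - √3 / 4 * l)]
  by_cases h0 : |x - √3 / 4 * l| / √3 + |y - 1 / 4| ≤ 1 / 2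
  · refine ⟨(0, l), ?_, hb, by simpa using h0⟩
    simp only [mem_filter, mem_product, mem_range]
    omega
  by_cases h2 : |x - √3 / 4 * l| / √3 + |y - 7 / 4| ≤ 1 / 2
  · refine ⟨(2, l), ?_, hb, ?_⟩
    · simp only [mem_filter, mem_product, mem_range]
      omega
    · norm_num at h2 ⊢
      exact h2
  refine ⟨(1, l'), ?_, hb', ?_⟩
  · simp only [mem_filter, mem_product, mem_range]
    omega
  · push Not at h0 h2
    have e : ((1 : ℕ) : ℝ) = 1 := Nat.cast_one
    simp only [e]
    -- Outside the lower and the upper cell, `y` is squeezed towards the middle height `1`, and the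
    -- margin is what the distance from `l'` leaves over.
    have hy : |y - (1 / 4 + 3 / 4 * 1)| < 1 / 4 + |x - √3 / 4 * l| / √3 := by
      rcases abs_cases (y - 1 / 4) with h | h <;> rcases abs_cases (y - 7 / 4) with h' | h' <;>
        rw [abs_lt] <;> constructor <;> linarith
    linarith

/-- The hexagonal partition is placed freely, with its rectangle at the slab and strip in question.
Its three rows have `5 + 6 + 5 = 16` cells, which saves the two powers of `n` needed for the number
of layers and the number of strips. -/
theorem MinDom.card_window_of_strip (hD : MinDom n X Y D T) (hT : T ⊆ range n) {y₀ : ℝ}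
    (hy : ∀ t ∈ T, y₀ ≤ Y t ∧ Y t ≤ y₀ + 2) (c : ℝ) :
    #(D.filter fun d => |X d - c| ≤ 1) ≤ 16 := by
  have hex : ∀ t ∈ T, |X t - c| ≤ 2 →
      ∃ z ∈ (range 3 ×ˢ range 11).filter fun z : ℕ × ℕ => (z.1 + z.2) % 2 = 1,
        InHex (√3 / 4 * z.2) (1 / 4 + 3 / 4 * z.1) (X t - c + 2) (Y t - y₀) := fun t ht hU => by
    obtain ⟨h₁, h₂⟩ := abs_le.1 hU
    obtain ⟨h₃, h₄⟩ := hy t ht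
    exact exists_hex_of_rectangle (by linarith) (by linarith) (by linarith) (by linarith)
  choose! cls hJ hc using hex
  refine (hD.card_le_of_classes hT (filter_subset _ _) (U := fun t => |X t - c| ≤ 2)
    (fun t _ d hd h => abs_sub_le_two (mem_filter.1 hd).2 h) _ cls hJ
    fun t ht t' ht' hU hU' h => ?_).trans (by decide)
  have h₁ := hc t ht hU
  rw [h] at h₁
  have := InHex.near (X := fun i => X i - c + 2) (Y := fun i => Y i - y₀) h₁ (hc t' ht' hU')
  simpa [Near] using this

end
end GeomMDS

/-! # The minimum cover of a duper-cell -/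

namespace GeomMDS

open Finset RealRAM

theorem mem_closedBall_iff {s d : Plane} :
    s ∈ Metric.closedBall d 1 ↔ (s 0 - d 0) ^ 2 + (s 1 - d 1) ^ 2 ≤ 1 := by
  rw [Metric.mem_closedBall, EuclideanSpace.dist_eq, Fin.sum_univ_two, Real.sqrt_le_one]
  simp only [Real.dist_eq, sq_abs]

/-! ### Points of the plane and their indices -/

section
variable {n : ℕ} {p : Fin n → Plane} {X Y : ℕ → ℝ}

/-- The numbers of the points in `D`. -/
noncomputable def indices (p : Fin n → Plane) (D : Finset Plane) : Finset ℕ :=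
  open Classical in (univ.filter fun i : Fin n => p i ∈ D).map Fin.valEmbedding

theorem mem_indices {D : Finset Plane} {k : ℕ} :
    k ∈ indices p D ↔ ∃ i : Fin n, p i ∈ D ∧ (i : ℕ) = k := by
  simp [indices]

theorem indices_subset (D : Finset Plane) : indices p D ⊆ range n := fun k hk => by
  obtain ⟨i, -, rfl⟩ := mem_indices.1 hk
  exact mem_range.2 i.2

theorem card_indices_le (hp : Function.Injective p) (D : Finset Plane) : #(indices p D) ≤ #D := by
  classical
  unfold indices
  rw [card_map]
  exact card_le_card_of_injOn p (fun i hi => (mem_filter.1 hi).2) hp.injOn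

theorem near_iff (hX : ∀ i : Fin n, X i = p i 0) (hY : ∀ i : Fin n, Y i = p i 1) {i j : Fin n} :
    Near X Y i j ↔ p j ∈ Metric.closedBall (p i) 1 := by
  rw [mem_closedBall_iff, Near, hX, hX, hY, hY]

theorem dom_indices (hX : ∀ i : Fin n, X i = p i 0) (hY : ∀ i : Fin n, Y i = p i 1)
    {D : Finset Plane} (hD : (D : Set Plane) ⊆ Set.range p) {T : Finset ℕ} {R : Set Plane}
    (hcov : Covers D R) (hT : ∀ t ∈ T, ∃ i : Fin n, (i : ℕ) = t ∧ p i ∈ R) :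
    Dom X Y (indices p D) T := by
  intro t ht
  obtain ⟨i, rfl, hi⟩ := hT t ht
  obtain ⟨d, hd, h⟩ := hcov _ hi
  obtain ⟨j, rfl⟩ := hD hd
  exact ⟨j, mem_indices.2 ⟨j, hd, rfl⟩, (near_iff hX hY).2 h⟩

theorem output_subset (p : Fin n → Plane) (m : Mem) : (output p m : Set Plane) ⊆ Set.range p := by
  classical
  intro q hq
  obtain ⟨i, -, rfl⟩ := mem_image.1 (mem_coe.1 hq)
  exact ⟨i, rfl⟩

theorem card_output_le {m : Mem} {O : Finset ℕ} (hO : ∀ i, m.nat 1 i = 1 → i ∈ O) :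
    #(output p m) ≤ #O := by
  classical
  refine card_image_le.trans (card_le_card_of_injOn (fun i : Fin n => (i : ℕ)) (fun i hi => ?_)
    Fin.val_injective.injOn)
  exact hO _ (mem_filter.1 hi).2

theorem covers_output (hX : ∀ i : Fin n, X i = p i 0) (hY : ∀ i : Fin n, Y i = p i 1) {m : Mem}
    {O T : Finset ℕ} (hOn : O ⊆ range n) (hO : ∀ i ∈ O, m.nat 1 i = 1) (hd : Dom X Y O T)
    {R : Set Plane} (hR : ∀ q ∈ R, ∃ i : Fin n, (i : ℕ) ∈ T ∧ p i = q) :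
    Covers (output p m) R := by
  classical
  intro q hq
  obtain ⟨i, hi, rfl⟩ := hR q hq
  obtain ⟨d, hdO, h⟩ := hd _ hi
  have hdn := mem_range.1 (hOn hdO)
  refine ⟨p ⟨d, hdn⟩, mem_image_of_mem _ (mem_filter.2 ⟨mem_univ _, hO d hdO⟩), ?_⟩
  exact (near_iff hX hY (i := ⟨d, hdn⟩)).1 h

end

/-- For `n ≥ 2` one has `n + 1 ≤ 2 n` and `log n ≥ log 2 ≥ 1/2`. -/
theorem time_bound {t c n k : ℕ} (h : t ≤ c * (n + 1) ^ k) (hn : 2 ≤ n) :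
    (t : ℝ) ≤ ((c : ℝ) * 2 ^ (k + 1)) * ((n : ℝ) ^ k * Real.log n) := by
  have h₁ : (t : ℝ) ≤ c * ((n : ℝ) + 1) ^ k := by exact_mod_cast h
  have hn' : (2 : ℝ) ≤ n := by exact_mod_cast hn
  have h₂ : ((n : ℝ) + 1) ^ k ≤ (2 * n) ^ k := pow_le_pow_left₀ (by linarith) (by linarith) k
  rw [mul_pow] at h₂
  have h₃ : (1 / 2 : ℝ) ≤ Real.log n := by
    have h₄ := Real.log_le_log (by norm_num) hn'
    have h₅ := Real.log_two_gt_d9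
    linarith
  have h₄ : (n : ℝ) ^ k * (1 / 2) ≤ (n : ℝ) ^ k * Real.log n :=
    mul_le_mul_of_nonneg_left h₃ (by positivity)
  calc (t : ℝ) ≤ c * ((n : ℝ) + 1) ^ k := h₁
    _ ≤ c * (2 ^ k * (n : ℝ) ^ k) := mul_le_mul_of_nonneg_left h₂ (Nat.cast_nonneg _)
    _ = (c * 2 ^ (k + 1)) * ((n : ℝ) ^ k * (1 / 2)) := by rw [pow_succ]; ring
    _ ≤ _ := mul_le_mul_of_nonneg_left h₄ (by positivity)

/-! ### Deciding membership in the duper-cell -/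

/-- An expression for the absolute value. -/
abbrev absExp (x : RExp) : RExp := .sqrt (.mul x x)

/-- The abscissa of the point in the variable `19`, relative to the centre of a cell. -/
def cellExpX (z : Fin 3 × Fin 10) : RExp :=
  .sub (.get 0 (var 19)) (.add (.get 2 (.lit 0)) (.mul (.div (.sqrt (.lit 3)) (.lit 2))
    (.add (.lit (z.2 : ℕ)) (.div (.lit (if z.1 = 1 then 1 else 0)) (.lit 2)))))

/-- The ordinate of the point in the variable `19`, relative to the centre of a cell. -/
def cellExpY (z : Fin 3 × Fin 10) : RExp :=
  .sub (.get 1 (var 19)) (.add (.get 2 (.lit 1)) (.mul (.div (.lit 3) (.lit 4)) (.lit (z.1 : ℕ))))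

/-- Make the point in the variable `19` a target if it lies in a certain cell. -/
def markCell (z : Fin 3 × Fin 10) : Cmd :=
  .ite (.rle (absExp (cellExpX z)) (.div (.sqrt (.lit 3)) (.lit 4)))
    (.ite (.rle (.add (.div (absExp (cellExpX z)) (.sqrt (.lit 3))) (absExp (cellExpY z)))
        (.div (.lit 1) (.lit 2)))
      (.setN 2 (var 19) (.lit 1)) .skip) .skip

theorem wp_markCell (z : Fin 3 × Fin 10) {m : Mem} {i : ℕ} (hi : m.nat 19 0 = i) :
    Wp (markCell z) m fun t m' => t ≤ 200 ∧ Same [2] m m' ∧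
      (1 ≤ m'.nat 2 i ↔ 1 ≤ m.nat 2 i ∨
        InHex (cellX (m.real 2 0) z) (cellY (m.real 2 1) z) (m.real 0 i) (m.real 1 i)) ∧
      ∀ j ≠ i, m'.nat 2 j = m.nat 2 j := by
  have hx : (cellExpX z).eval m = m.real 0 i - cellX (m.real 2 0) z := by
    simp only [cellExpX, cellX, RExp.eval, NExp.eval, hi]
    split_ifs <;> simp
  have hy : (cellExpY z).eval m = m.real 1 i - cellY (m.real 2 1) z := by
    simp [cellExpY, cellY, RExp.eval, NExp.eval, hi]
  have e1 : (Cond.rle (absExp (cellExpX z)) (.div (.sqrt (.lit 3)) (.lit 4))).Holds m ↔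
      |m.real 0 i - cellX (m.real 2 0) z| ≤ √3 / 4 := by
    simp [Cond.Holds, RExp.eval, hx, Real.sqrt_mul_self_eq_abs]
  have e2 : (Cond.rle (.add (.div (absExp (cellExpX z)) (.sqrt (.lit 3))) (absExp (cellExpY z)))
        (.div (.lit 1) (.lit 2))).Holds m ↔
      |m.real 0 i - cellX (m.real 2 0) z| / √3 + |m.real 1 i - cellY (m.real 2 1) z| ≤ 1 / 2 := by
    simp [Cond.Holds, RExp.eval, hx, hy, Real.sqrt_mul_self_eq_abs]
  unfold markCell
  simp only [wp_ite, wp_setN, wp_skip, e1, e2]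
  simp only [InHex]
  refine ⟨fun h => ⟨fun h' => ?_, fun h' => ?_⟩, fun h => ?_⟩
  · refine ⟨?_, (Same.refl _ m).writeN (by decide) _ _, ?_, fun j hj => ?_⟩
    · simp [Cond.cost, RExp.cost, NExp.cost, cellExpX, cellExpY]
    · simp only [nat_writeN, NExp.eval, hi]
      simp only [if_true, Function.update_self, le_refl, true_iff]
      exact .inr ⟨h, h'⟩
    · simp [nat_writeN, NExp.eval, hi, hj]
  · refine ⟨?_, Same.refl _ m, ?_, fun _ _ => trivial⟩
    · simp [Cond.cost, RExp.cost, NExp.cost, cellExpX, cellExpY]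
    · exact ⟨.inl, fun H => H.resolve_right fun H => h' H.2⟩
  · refine ⟨?_, Same.refl _ m, ?_, fun _ _ => trivial⟩
    · simp [Cond.cost, RExp.cost, NExp.cost, cellExpX]
    · exact ⟨.inl, fun H => H.resolve_right fun H => h H.1⟩

/-- Make the point in the variable `19` a target if it lies in one of certain cells. -/
def markCells : List (Fin 3 × Fin 10) → Cmd
  | [] => .setN 2 (var 19) (.lit 0)
  | z :: l => .seq (markCells l) (markCell z)

theorem wp_markCells (l : List (Fin 3 × Fin 10)) {m : Mem} {i : ℕ} (hi : m.nat 19 0 = i) :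
    Wp (markCells l) m fun t m' => t ≤ 200 * (l.length + 1) ∧ Same [2] m m' ∧
      (1 ≤ m'.nat 2 i ↔ ∃ z ∈ l,
        InHex (cellX (m.real 2 0) z) (cellY (m.real 2 1) z) (m.real 0 i) (m.real 1 i)) ∧
      ∀ j ≠ i, m'.nat 2 j = m.nat 2 j := by
  induction l with
  | nil =>
    rw [markCells, wp_setN]
    refine ⟨by decide, (Same.refl _ m).writeN (by decide) _ _, ?_, fun j hj => ?_⟩
    · simp [nat_writeN, NExp.eval, hi]
    · simp [nat_writeN, NExp.eval, hi, hj]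
  | cons z l ih =>
    rw [markCells, wp_seq]
    refine ih.conseq ?_
    rintro t₁ m₁ ⟨ht₁, hS₁, hc₁, hj₁⟩
    refine (wp_markCell z (by rw [hS₁.2 19 (by decide), hi])).conseq ?_
    rintro t₂ m₂ ⟨ht₂, hS₂, hc₂, hj₂⟩
    refine ⟨?_, hS₁.trans hS₂ (by decide), ?_, fun j hj => (hj₂ j hj).trans (hj₁ j hj)⟩
    · rw [List.length_cons]; omega
    · rw [hc₂, hc₁, hS₁.1, List.exists_mem_cons_iff, or_comm]

/-- Make the points of the duper-cell the targets. -/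
def markDuperCell : Cmd :=
  forN 19 (var 0) (markCells (List.finRange 3 ×ˢ List.finRange 10))

theorem wp_markDuperCell {n : ℕ} {m : Mem} (hn : m.nat 0 0 = n) :
    Wp markDuperCell m fun t m' => t ≤ 7000 * (n + 1) ∧ Same [2, 19] m m' ∧
      ∀ i < n, (1 ≤ m'.nat 2 i ↔ ∃ z : Fin 3 × Fin 10,
        InHex (cellX (m.real 2 0) z) (cellY (m.real 2 1) z) (m.real 0 i) (m.real 1 i)) := by
  unfold markDuperCell
  refine (Wp.forN n 6200 (fun k m' => Same [2, 19] m m' ∧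
    ∀ i < k, (1 ≤ m'.nat 2 i ↔ ∃ z : Fin 3 × Fin 10,
        InHex (cellX (m.real 2 0) z) (cellY (m.real 2 1) z) (m.real 0 i) (m.real 1 i)))
    ?_ ?_ ?_).conseq ?_
  · exact ⟨(Same.refl _ m).writeN (by decide) _ _, by simp⟩
  · rintro k m' ⟨hS, -⟩
    simp [NExp.eval, hS.2 0 (by decide), hn]
  · rintro k hk m₁ ⟨hS, hc⟩ h19
    refine (wp_markCells _ h19).conseq ?_
    rintro t m₂ ⟨ht, hS₂, hc₂, hj⟩
    refine ⟨ht.trans (by decide), by rw [hS₂.2 19 (by decide), h19],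
      (hS.trans hS₂ (by decide)).writeN (by decide) _ _, fun i hi => ?_⟩
    rw [nat_writeN, if_neg (by decide)]
    rcases (Nat.lt_succ_iff.1 hi).eq_or_lt with rfl | hi
    · rw [hc₂, hS.1]
      simp
    · rw [hj i hi.ne]
      exact hc i hi
  · rintro t m' ⟨ht, ⟨hS, hc⟩, -⟩
    refine ⟨?_, hS, hc⟩
    simp only [NExp.cost] at ht
    omega

theorem mem_duperCell_iff {a q : Plane} :
    q ∈ duperCell a ↔ ∃ z : Fin 3 × Fin 10, InHex (cellX (a 0) z) (cellY (a 1) z) (q 0) (q 1) := by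
  simp only [duperCell, Set.mem_iUnion, Prod.exists]
  rfl

theorem exists_minCover_program : ∃ (P : RealRAM.Cmd) (K : ℝ),
    ∀ (n : ℕ) (p : Fin n → Plane), Function.Injective p → ∀ a : Plane,
      ∃ (t : ℕ) (m : RealRAM.Mem), RealRAM.Exec P (pointsCellInput p a) t m ∧
        (2 ≤ n → (t : ℝ) ≤ K * ((n : ℝ) ^ 20 * Real.log (n : ℝ))) ∧
        IsMinCover (Set.range p) (Set.range p ∩ duperCell a) (output p m) := by
  classical
  refine ⟨.seq markDuperCell (solve 18), ((5000000 : ℕ) : ℝ) * 2 ^ (20 + 1), fun n p hp a => ?_⟩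
  set m := pointsCellInput p a with hm
  have h2 : m.real 2 0 = a 0 ∧ m.real 2 1 = a 1 := by
    simp [hm, pointsCellInput, Mem.writeR]
  have hn : m.nat 0 0 = n := by simp [hm, pointsCellInput, pointsInput, Mem.writeR]
  have hnat : ∀ A i, A ≠ 0 → m.nat A i = 0 := fun A i hA => by
    simp [hm, pointsCellInput, pointsInput, Mem.writeR, hA]
  have hX : ∀ i : Fin n, m.real 0 i = p i 0 := fun i => by
    simp [hm, pointsCellInput, pointsInput, Mem.writeR]
  have hY : ∀ i : Fin n, m.real 1 i = p i 1 := fun i => by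
    simp [hm, pointsCellInput, pointsInput, Mem.writeR]
  set T := (range n).filter fun i => ∃ z : Fin 3 × Fin 10,
    InHex (cellX (a 0) z) (cellY (a 1) z) (m.real 0 i) (m.real 1 i) with hTdef
  have hT : T ⊆ range n := filter_subset _ _
  have hcell : ∀ t ∈ T, ∃ z : Fin 3 × Fin 10,
    InHex (cellX (a 0) z) (cellY (a 1) z) (m.real 0 t) (m.real 1 t) :=
      fun t ht => (mem_filter.1 ht).2
  have hTR : ∀ i : Fin n, (i : ℕ) ∈ T ↔ p i ∈ duperCell a := fun i => by
    rw [hTdef, mem_filter, mem_duperCell_iff, hX, hY, mem_range]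
    simp
  obtain ⟨D, hD⟩ := exists_minDom (n := n) (X := m.real 0) (Y := m.real 1) hT
  have hwp : Wp (.seq markDuperCell (solve 18)) m fun t m' => t ≤ 5000000 * (n + 1) ^ 20 ∧
      ∃ O ⊆ range n, Dom (m.real 0) (m.real 1) O T ∧ #O ≤ #D ∧ ∀ i, m'.nat 1 i = 1 ↔ i ∈ O := by
    rw [wp_seq]
    refine (wp_markDuperCell hn).conseq ?_
    rintro t₁ m₁ ⟨ht₁, hS₁, hc⟩
    refine (wp_solve (by decide) (by rw [hS₁.2 0 (by decide), hn]) (by rw [hS₁.1]) (by rw [hS₁.1])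
      hT (fun t ht => ?_) (fun j _ => by rw [hS₁.2 4 (by decide), hnat _ _ (by decide)]) hD
      (hD.card_window_of_duperCell hT hcell)).conseq ?_
    · rw [hc t ht, h2.1, h2.2, hTdef, mem_filter, mem_range]
      simp [ht]
    · rintro t₂ m₂ ⟨ht₂, -, -, O, h₁, h₃, h₄, h₅⟩
      refine ⟨?_, O, h₁, h₃, h₄, fun i => ?_⟩
      -- At most `30` points in a minimum cover mean a factor `32` in the bound for `solve 18`,
      -- independent of `n`; so the exponent remains `18 + 2 = 20`.
      · have h30 := hD.card_le_of_duperCell hT hcell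
        have hB : n + 1 ≤ (n + 1) ^ 20 := Nat.le_self_pow (by decide) _
        have := Nat.mul_le_mul_right (7000 * (18 + 1) * (n + 1) ^ (18 + 2))
          (show #D + 2 ≤ 32 by omega)
        simp only [Nat.reduceAdd, Nat.reduceMul] at this ht₂
        generalize (n + 1) ^ 20 = Z at *
        omega
      · rw [h₅, hS₁.2 1 (by decide), hnat _ _ (by decide)]
        simp
  obtain ⟨t, m', hex, ht, O, hOn, hdom, hcard, hout⟩ := hwp
  refine ⟨t, m', hex, fun h => time_bound ht h, output_subset p m', ?_, fun D' hD' hcov => ?_⟩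
  · refine covers_output hX hY hOn (fun i hi => (hout i).2 hi) hdom ?_
    rintro _ ⟨⟨i, rfl⟩, hi⟩
    exact ⟨i, (hTR i).2 hi, rfl⟩
  · calc #(output p m') ≤ #O := card_output_le fun i hi => (hout i).1 hi
      _ ≤ #D := hcard
      _ ≤ #(indices p D') := hD.2.2 _ (indices_subset D') (dom_indices hX hY hD' hcov fun t ht =>
          ⟨⟨t, mem_range.1 (hT ht)⟩, rfl, ⟨_, rfl⟩, (hTR ⟨t, mem_range.1 (hT ht)⟩).1 ht⟩)
      _ ≤ #D' := card_indices_le hp D'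

end GeomMDS

/-! # Approximation by horizontal strips

The program takes the lowest unprocessed point, makes the unprocessed points that are less than `2`
above it the targets, adds a minimum cover of them to the output, and repeats this. -/

namespace GeomMDS

open Finset RealRAM

/-- Let the variable `18` be the number of the lowest point without a flag in array `3`, or `n` if all
points have the flag. -/
def lowest : Cmd :=
  .seq (setVar 18 (var 0))
    (forN 19 (var 0)
      (.ite (.nle (.lit 1) (.get 3 (var 19))) .skip
        (iteOr (.nle (var 0) (var 18)) (.rle (.get 1 (var 19)) (.get 1 (var 18)))
          (setVar 18 (var 19)) .skip)))

/-- `s` is the lowest of the first `k` points without a flag, or `n` if there is none. -/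
def IsLowest (n : ℕ) (Y : ℕ → ℝ) (f : ℕ → ℕ) (k s : ℕ) : Prop :=
  (s = n ∧ ∀ i < k, 1 ≤ f i) ∨ (s < n ∧ f s = 0 ∧ ∀ i < k, f i = 0 → Y s ≤ Y i)

theorem wp_lowest {n : ℕ} {m : Mem} (hn : m.nat 0 0 = n) :
    Wp lowest m fun t m' => t ≤ 100 * (n + 1) ∧ Same [18, 19] m m' ∧
      IsLowest n (m.real 1) (m.nat 3) n (m'.nat 18 0) := by
  unfold lowest
  simp only [wp_seq, wp_setN]
  refine (Wp.forN n 50 (fun k m' => Same [18, 19] m m' ∧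
    IsLowest n (m.real 1) (m.nat 3) k (m'.nat 18 0)) ?_ ?_ ?_).conseq ?_
  · refine ⟨((Same.refl _ m).writeN (by decide) _ _).writeN (by decide) _ _, .inl ?_⟩
    simp [nat_writeN, NExp.eval, hn]
  · rintro k m' ⟨hS, -⟩
    simp [NExp.eval, hS.2 0 (by decide), hn]
  · rintro k hk m₁ ⟨hS, hI⟩ h19
    have e3 : m₁.nat 3 = m.nat 3 := hS.2 3 (by decide)
    have e0 : m₁.nat 0 0 = n := by rw [hS.2 0 (by decide), hn]
    set s := m₁.nat 18 0 with hs
    rw [wp_ite, wp_skip]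
    refine ⟨fun hf => ?_, fun hf => ?_⟩
    · have hf : 1 ≤ m.nat 3 k := by simpa [Cond.Holds, NExp.eval, h19, e3] using hf
      refine ⟨by decide, h19, hS.writeN (by decide) _ _, ?_⟩
      rw [nat_writeN, if_neg (by decide), ← hs]
      refine hI.imp (fun H => ⟨H.1, fun i hi => ?_⟩) fun H => ⟨H.1, H.2.1, fun i hi h0 => ?_⟩
      · rcases (Nat.lt_succ_iff.1 hi).eq_or_lt with rfl | hi
        · exact hf
        · exact H.2 i hi
      · rcases (Nat.lt_succ_iff.1 hi).eq_or_lt with rfl | hi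
        · omega
        · exact H.2.2 i hi h0
    · have hf : m.nat 3 k = 0 := by simpa [Cond.Holds, NExp.eval, h19, e3] using hf
      refine (wp_iteOr (b := 5) (Q := fun m' => m'.nat 19 0 = k ∧
        Same [18, 19] m (m'.writeN 19 0 (k + 1)) ∧
        IsLowest n (m.real 1) (m.nat 3) (k + 1) ((m'.writeN 19 0 (k + 1)).nat 18 0))
        (fun hc => ?_) (fun hc hc' => ?_)).conseq fun t m' H => ⟨?_, H.2⟩
      · rw [wp_setN]
        refine ⟨by decide, by simpa [nat_writeN] using h19,
          (hS.writeN (by decide) _ _).writeN (by decide) _ _, .inr ?_⟩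
        simp only [nat_writeN, NExp.eval, h19]
        simp only [Nat.reduceEqDiff, if_false, if_true, Function.update_self]
        refine ⟨hk, hf, fun i hi h0 => ?_⟩
        rcases (Nat.lt_succ_iff.1 hi).eq_or_lt with rfl | hi
        · exact le_rfl
        · rcases hI with H | H
          · have := H.2 i hi
            omega
          · refine le_trans ?_ (H.2.2 i hi h0)
            rcases hc with hc | hc
            · simp only [Cond.Holds, NExp.eval, e0, ← hs] at hc
              omega
            · simpa [Cond.Holds, RExp.eval, NExp.eval, h19, ← hs, hS.1] using hc
      · rw [wp_skip]
        refine ⟨by decide, h19, hS.writeN (by decide) _ _, .inr ?_⟩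
        rw [nat_writeN, if_neg (by decide), ← hs]
        simp only [Cond.Holds, NExp.eval, e0, ← hs, not_le] at hc
        rcases hI with H | H
        · omega
        · refine ⟨H.1, H.2.1, fun i hi h0 => ?_⟩
          rcases (Nat.lt_succ_iff.1 hi).eq_or_lt with rfl | hi
          · have : m.real 1 s < m.real 1 i := by
              simpa [Cond.Holds, RExp.eval, NExp.eval, h19, ← hs, hS.1] using hc'
            exact this.le
          · exact H.2.2 i hi h0
      · have := H.1
        simp only [Cond.cost, NExp.cost, RExp.cost] at this ⊢
        omega
  · rintro t m' ⟨ht, ⟨hS, hI⟩, -⟩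
    refine ⟨?_, hS, hI⟩
    simp only [NExp.cost] at ht ⊢
    omega

/-- Make the points without a flag in array `3` that are less than `2` above the point in the variable
`18` the targets, and give them the flag. -/
def markStrip : Cmd :=
  forN 19 (var 0)
    (.seq (.setN 2 (var 19) (.lit 0))
      (.ite (.nle (.lit 1) (.get 3 (var 19))) .skip
        (.ite (.rle (.add (.get 1 (var 18)) (.lit 2)) (.get 1 (var 19))) .skip
          (.seq (.setN 2 (var 19) (.lit 1)) (.setN 3 (var 19) (.lit 1))))))

theorem wp_markStrip {n s : ℕ} {m : Mem} (hn : m.nat 0 0 = n) (hs : m.nat 18 0 = s) :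
    Wp markStrip m fun t m' => t ≤ 100 * (n + 1) ∧ Same [2, 3, 19] m m' ∧
      ∀ i < n, (1 ≤ m'.nat 2 i ↔ m.nat 3 i = 0 ∧ m.real 1 i < m.real 1 s + 2) ∧
        (1 ≤ m'.nat 3 i ↔ 1 ≤ m.nat 3 i ∨ m.real 1 i < m.real 1 s + 2) := by
  unfold markStrip
  -- Flags are overwritten in place, so the invariant also records that those from `k` on are still
  -- the old ones.
  refine (Wp.forN n 50 (fun k m' => Same [2, 3, 19] m m' ∧ (∀ i, k ≤ i → m'.nat 3 i = m.nat 3 i) ∧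
      ∀ i < k, (1 ≤ m'.nat 2 i ↔ m.nat 3 i = 0 ∧ m.real 1 i < m.real 1 s + 2) ∧
        (1 ≤ m'.nat 3 i ↔ 1 ≤ m.nat 3 i ∨ m.real 1 i < m.real 1 s + 2)) ?_ ?_ ?_).conseq ?_
  · refine ⟨(Same.refl _ m).writeN (by decide) _ _, ?_, by simp⟩
    simp [nat_writeN]
  · rintro k m' ⟨hS, -⟩
    simp [NExp.eval, hS.2 0 (by decide), hn]
  · rintro k hk m₁ ⟨hS, h3, hI⟩ h19
    have e18 : m₁.nat 18 0 = s := by rw [hS.2 18 (by decide), hs]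
    have e3 : m₁.nat 3 k = m.nat 3 k := h3 k le_rfl
    simp only [wp_seq, wp_setN, wp_ite, wp_skip]
    simp only [Cond.Holds, NExp.eval, RExp.eval, h19, nat_writeN, real_writeN, Nat.reduceEqDiff,
      if_false, if_true, e18, hS.1, e3, Int.cast_ofNat, not_le]
    refine ⟨fun hf => ?_, fun hf => ⟨fun hy => ?_, fun hy => ?_⟩⟩
    · refine ⟨by decide, trivial, (hS.writeN (by decide) _ _).writeN (by decide) _ _,
        fun i hi => h3 i (by omega), fun i hi => ?_⟩
      rcases (Nat.lt_succ_iff.1 hi).eq_or_lt with rfl | hi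
      · rw [Function.update_self, e3]
        exact ⟨⟨fun h => absurd h (by decide), fun h => by omega⟩, by simp [hf]⟩
      · rw [Function.update_of_ne hi.ne]
        exact hI i hi
    · refine ⟨by decide, trivial, (hS.writeN (by decide) _ _).writeN (by decide) _ _,
        fun i hi => h3 i (by omega), fun i hi => ?_⟩
      rcases (Nat.lt_succ_iff.1 hi).eq_or_lt with rfl | hi
      · rw [Function.update_self, e3]
        exact ⟨⟨fun h => absurd h (by decide), fun h => absurd h.2 (not_lt.2 hy)⟩,
          by simp [hy]⟩
      · rw [Function.update_of_ne hi.ne]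
        exact hI i hi
    · refine ⟨by decide, trivial, (((hS.writeN (by decide) _ _).writeN (by decide) _ _).writeN
        (by decide) _ _).writeN (by decide) _ _, fun i hi => ?_, fun i hi => ?_⟩
      · rw [Function.update_of_ne (by omega)]
        exact h3 i (by omega)
      · rcases (Nat.lt_succ_iff.1 hi).eq_or_lt with rfl | hi
        · simp only [Function.update_self, le_refl, true_iff]
          exact ⟨⟨by omega, hy⟩, .inr hy⟩
        · rw [Function.update_of_ne hi.ne, Function.update_of_ne hi.ne, Function.update_of_ne hi.ne]
          exact hI i hi
  · rintro t m' ⟨ht, ⟨hS, -, hI⟩, -⟩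
    refine ⟨?_, hS, hI⟩
    simp only [NExp.cost] at ht ⊢
    omega

/-- Cover all points, strip by strip. -/
def coverStrips : Cmd :=
  forN 20 (var 0) (.seq lowest (.seq markStrip (solve 16)))

/-! ### Charging the strips to a dominating set -/

/-- The strips below the height `θ` have been covered by `O`, at a cost that is charged to the points of
a dominating set `D`. -/
def Charged (n : ℕ) (X Y : ℕ → ℝ) (D O : Finset ℕ) (f : ℕ → ℕ) (θ : ℝ) : Prop :=
  (∀ i < n, 1 ≤ f i ↔ Y i < θ) ∧ O ⊆ range n ∧
    Dom X Y O ((range n).filter fun i => 1 ≤ f i) ∧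
    #O ≤ #(D.filter fun d => Y d < θ - 1) + #(D.filter fun d => Y d < θ + 1)

/-- The strip with base `y` is served only by points of `D` with ordinate in `[y - 1, y + 3)`, and
bases are at least `2` apart, so no point of `D` is charged more than twice. The two terms of the
bound count the points by multiplicity: those below `θ - 1` may have been charged twice, those
between `θ - 1` and `θ + 1` only once. -/
theorem Charged.union {n : ℕ} {X Y : ℕ → ℝ} {D O O' : Finset ℕ} {f f' : ℕ → ℕ} {θ y : ℝ}
    (h : Charged n X Y D O f θ) (hy : θ ≤ y) (hf : ∀ i < n, 1 ≤ f' i ↔ 1 ≤ f i ∨ Y i < y + 2)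
    (hO' : O' ⊆ range n) (hdom : Dom X Y O' ((range n).filter fun i => f i = 0 ∧ Y i < y + 2))
    (hcard : #O' ≤ #(D.filter fun d => y - 1 ≤ Y d ∧ Y d < y + 3)) :
    Charged n X Y D (O ∪ O') f' (y + 2) := by
  obtain ⟨h₁, h₂, h₃, h₄⟩ := h
  refine ⟨fun i hi => ?_, union_subset h₂ hO', fun t ht => ?_, ?_⟩
  · rw [hf i hi, h₁ i hi]
    exact ⟨fun H => H.elim (fun H => by linarith) id, .inr⟩
  · obtain ⟨htn, ht⟩ := mem_filter.1 ht
    by_cases h0 : 1 ≤ f t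
    · obtain ⟨d, hd, hdt⟩ := h₃ t (mem_filter.2 ⟨htn, h0⟩)
      exact ⟨d, mem_union_left _ hd, hdt⟩
    · obtain ⟨d, hd, hdt⟩ := hdom t (mem_filter.2 ⟨htn, by omega,
        ((hf t (mem_range.1 htn)).1 ht).resolve_left h0⟩)
      exact ⟨d, mem_union_right _ hd, hdt⟩
  · have hu := card_union_le O O'
    have e₁ : #(D.filter fun d => Y d < θ + 1) ≤ #(D.filter fun d => Y d < y + 2 - 1) :=
      card_le_card (monotone_filter_right D fun d _ hd => by linarith)
    -- As `θ ≤ y`, the points charged anew lie above those below `θ - 1`, and both kinds lie below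
    -- the new threshold plus `1`.
    have e₂ : #(D.filter fun d => Y d < θ - 1) + #(D.filter fun d => y - 1 ≤ Y d ∧ Y d < y + 3) ≤
        #(D.filter fun d => Y d < y + 2 + 1) := by
      rw [← card_union_of_disjoint]
      · refine card_le_card fun d hd => ?_
        simp only [mem_union, mem_filter] at hd ⊢
        rcases hd with ⟨h, h'⟩ | ⟨h, -, h'⟩
        · exact ⟨h, by linarith⟩
        · exact ⟨h, by linarith⟩
      · rw [disjoint_filter]
        intro d _ h h'
        linarith [h'.1]
    omega

-- There are always `n` rounds. A round either flags at least one new point, namely the lowest, or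
-- finds all points flagged and changes nothing in the output. The set `D` is only used to charge
-- the cost.
set_option maxHeartbeats 800000 in
theorem wp_coverStrips {n : ℕ} {m : Mem} {D : Finset ℕ} (hn : m.nat 0 0 = n)
    (hnat : ∀ A i, A ≠ 0 → m.nat A i = 0)
    (hD : Dom (m.real 0) (m.real 1) D (range n)) (hDn : D ⊆ range n) :
    Wp coverStrips m fun t m' => t ≤ 500000 * (n + 1) ^ 20 ∧
      ∃ O ⊆ range n, Dom (m.real 0) (m.real 1) O (range n) ∧ #O ≤ 2 * #D ∧
        ∀ i, m'.nat 1 i = 1 ↔ i ∈ O := by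
  classical
  set X := m.real 0 with hX
  set Y := m.real 1 with hY
  unfold coverStrips
  refine (Wp.forN n (400000 * (n + 1) ^ 19)
    (fun k m' => Same [1, 2, 3, 4, 5, 6, 7, 8, 9, 10, 11, 12, 13, 14, 15, 16, 17, 18, 19, 20] m m' ∧
      (∀ j < (n + 1) ^ 16, m'.nat 4 j = 0) ∧
      ((∀ i < n, 1 ≤ m'.nat 3 i) ∨ k ≤ #((range n).filter fun i => 1 ≤ m'.nat 3 i)) ∧
      ∃ O θ, Charged n X Y D O (m'.nat 3) θ ∧ ∀ i, m'.nat 1 i = 1 ↔ i ∈ O) ?_ ?_ ?_).conseq ?_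
  · refine ⟨(Same.refl _ m).writeN (by decide) _ _, ?_, .inr (Nat.zero_le _), ?_⟩
    · intro j _
      rw [nat_writeN, if_neg (by decide), hnat _ _ (by decide)]
    -- The initial threshold is any lower bound of the ordinates, so no point is below it.
    · obtain ⟨θ, hθ⟩ : ∃ θ, ∀ i ∈ range n, θ ≤ Y i := by
        obtain ⟨θ, hθ⟩ := ((range n).image Y).bddBelow
        exact ⟨θ, fun i hi => hθ (mem_coe.2 (mem_image_of_mem Y hi))⟩
      have h3 : ∀ i, (m.writeN 20 0 0).nat 3 i = 0 := fun i => by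
        rw [nat_writeN, if_neg (by decide), hnat _ _ (by decide)]
      refine ⟨∅, θ, ⟨fun i hi => ?_, empty_subset _, ?_, by simp⟩, fun i => ?_⟩
      · simpa [h3] using hθ i (mem_range.2 hi)
      · intro t ht
        simp [h3] at ht
      · rw [nat_writeN, if_neg (by decide), hnat _ _ (by decide)]
        simp
  · rintro k m' ⟨hS, -⟩
    simp [NExp.eval, hS.2 0 (by decide), hn]
  · rintro k hk m₁ ⟨hS₁, hz₁, hk₁, O, θ, hCh, hout⟩ h20
    have e0 : m₁.nat 0 0 = n := by rw [hS₁.2 0 (by decide), hn]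
    have r1 : m₁.real 1 = Y := by rw [hS₁.1]
    rw [wp_seq]
    refine (wp_lowest e0).conseq ?_
    rintro t₂ m₂ ⟨ht₂, hS₂, hlow⟩
    rw [r1] at hlow
    rw [wp_seq]
    refine (wp_markStrip (by rw [hS₂.2 0 (by decide), e0]) rfl).conseq ?_
    rintro t₃ m₃ ⟨ht₃, hS₃, hmark⟩
    set s := m₂.nat 18 0 with hs
    rw [hS₂.1, r1, hS₂.2 3 (by decide)] at hmark
    set f := m₁.nat 3 with hf
    set T := (range n).filter fun i => f i = 0 ∧ Y i < Y s + 2 with hTdef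
    have hT : T ⊆ range n := filter_subset _ _
    have hS13 : Same [1, 2, 3, 4, 5, 6, 7, 8, 9, 10, 11, 12, 13, 14, 15, 16, 17, 18, 19, 20] m m₃ :=
      (hS₁.trans hS₂ (by decide)).trans hS₃ (by decide)
    have hTs : ∀ t ∈ T, Y s ≤ Y t ∧ Y t ≤ Y s + 2 := fun t ht => by
      obtain ⟨h₁, h₂, h₃⟩ := mem_filter.1 ht
      rcases hlow with ⟨-, H⟩ | ⟨-, -, H⟩
      · have := H t (mem_range.1 h₁)
        omega
      · exact ⟨H t (mem_range.1 h₁) h₂, h₃.le⟩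
    obtain ⟨E, hE⟩ := exists_minDom (n := n) (X := X) (Y := Y) hT
    refine (wp_solve (w := 16) (by decide) (by rw [hS13.2 0 (by decide), hn])
      (by rw [hS13.1]) (by rw [hS13.1]) hT (fun t ht => ?_) (fun j hj => ?_) hE
      (hE.card_window_of_strip hT hTs)).conseq ?_
    · rw [(hmark t ht).1, hTdef, mem_filter, mem_range]
      simp [ht]
    · rw [hS₃.2 4 (by decide), hS₂.2 4 (by decide), hz₁ j hj]
    · rintro t₄ m₄ ⟨ht₄, hS₄, hz₄, O', hO'n, hO'T, hO'E, hout₄⟩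
      have e3 : m₄.nat 3 = m₃.nat 3 := hS₄.2 3 (by decide)
      refine ⟨?_, ?_, (hS13.trans hS₄ (by decide)).writeN (by decide) _ _, ?_, ?_, ?_⟩
      · have hEn : #E ≤ n := (card_le_card hE.1).trans (card_range n).le
        have h₁ := Nat.mul_le_mul_right (7000 * (16 + 1) * (n + 1) ^ (16 + 2))
          (show #E + 2 ≤ 2 * (n + 1) by omega)
        have h₂ : 2 * (n + 1) * (7000 * (16 + 1) * (n + 1) ^ (16 + 2)) =
          238000 * (n + 1) ^ 19 := by ring
        have hB : n + 1 ≤ (n + 1) ^ 19 := Nat.le_self_pow (by decide) _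
        rw [h₂] at h₁
        generalize (n + 1) ^ 19 = Z at *
        omega
      · rw [hS₄.2 20 (by decide), hS₃.2 20 (by decide), hS₂.2 20 (by decide), h20]
      · intro j hj
        rw [nat_writeN, if_neg (by decide), hz₄ j hj]
      · simp only [nat_writeN, Nat.reduceEqDiff, if_false, e3]
        rcases hlow with ⟨-, H⟩ | ⟨hsn, hs0, -⟩
        · exact .inl fun i hi => ((hmark i hi).2).2 (.inl (H i hi))
        · rcases hk₁ with hk₁ | hk₁
          · have := hk₁ s hsn
            omega
          · refine .inr (lt_of_le_of_lt hk₁ (card_lt_card ⟨?_, fun hsub => ?_⟩))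
            · intro i hi
              obtain ⟨h₁, h₂⟩ := mem_filter.1 hi
              exact mem_filter.2 ⟨h₁, (hmark i (mem_range.1 h₁)).2.2 (.inl h₂)⟩
            · have := hsub (mem_filter.2 ⟨mem_range.2 hsn,
                (hmark s hsn).2.2 (.inr (by linarith))⟩)
              have := (mem_filter.1 this).2
              omega
      · simp only [nat_writeN, Nat.reduceEqDiff, if_false, e3]
        have hout' : ∀ i, m₄.nat 1 i = 1 ↔ i ∈ O ∪ O' := fun i => by
          rw [hout₄, hS₃.2 1 (by decide), hS₂.2 1 (by decide), hout, mem_union]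
        rcases hlow with ⟨-, H⟩ | ⟨hsn, hs0, -⟩
        -- An idle round: there are no targets, the minimum cover is empty, and hence nothing is
        -- added. The strip's base is then read from the unused cell `n`, which is harmless.
        · have hTe : T = ∅ := by
            rw [hTdef, filter_eq_empty_iff]
            intro i hi h
            have := H i (mem_range.1 hi)
            omega
          have hE0 : #E ≤ #(∅ : Finset ℕ) :=
            hE.2.2 ∅ (empty_subset _) (by rw [hTe]; intro t ht; simp at ht)
          have hO'0 : O' = ∅ := card_eq_zero.1 (by simp at hE0; rw [hE0] at hO'E; simpa using hO'E)
          refine ⟨O, θ, ⟨fun i hi => ?_, hCh.2.1, fun t ht => ?_, hCh.2.2.2⟩, fun i => ?_⟩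
          · rw [← hCh.1 i hi, (hmark i hi).2]
            exact ⟨fun _ => H i hi, .inl⟩
          · have htn := (mem_filter.1 ht).1
            exact hCh.2.2.1 t (mem_filter.2 ⟨htn, H t (mem_range.1 htn)⟩)
          · rw [hout', hO'0, union_empty]
        · have hθs : θ ≤ Y s := by
            have := (hCh.1 s hsn).not
            rw [not_lt] at this
            exact this.1 (by omega)
          refine ⟨O ∪ O', Y s + 2, hCh.union hθs (fun i hi => (hmark i hi).2) hO'n hO'T
            (hO'E.trans (hE.2.2 _ ((filter_subset _ _).trans hDn) fun t ht => ?_)), hout'⟩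
          -- The points of `D` with ordinate in `[Y s - 1, Y s + 3)` form a competitor to the
          -- minimum cover `E` of the strip.
          obtain ⟨d, hd, hdt⟩ := hD t (hT ht)
          obtain ⟨h₁, -, h₃⟩ := mem_filter.1 ht
          have h₂ := (hTs t ht).1
          have hy := abs_le.1 hdt.abs_snd_le
          exact ⟨d, mem_filter.2 ⟨hd, by linarith only [hy.2, h₂], by linarith only [hy.1, h₃]⟩, hdt⟩
  · rintro t m' ⟨ht, ⟨-, -, hall, O, θ, hCh, hout⟩, -⟩
    have hall : ∀ i < n, 1 ≤ m'.nat 3 i := by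
      rcases hall with h | h
      · exact h
      -- After `n` rounds with a new flag each, all `n` points are flagged.
      · have := eq_of_subset_of_card_le (filter_subset (fun i => 1 ≤ m'.nat 3 i) (range n))
          (by rwa [card_range])
        exact fun i hi => filter_eq_self.1 this i (mem_range.2 hi)
    refine ⟨?_, O, hCh.2.1, fun t ht => hCh.2.2.1 t (mem_filter.2 ⟨ht, hall t (mem_range.1 ht)⟩),
      ?_, hout⟩
    · have hB : 1 ≤ (n + 1) ^ 19 := Nat.one_le_iff_ne_zero.2 (by positivity)
      have e : (n + 1) ^ 20 = (n + 1) * (n + 1) ^ 19 := pow_succ' _ _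
      simp only [NExp.cost] at ht
      rw [e]
      generalize (n + 1) ^ 19 = Z at *
      have h₁ := Nat.mul_le_mul_left (n + 1) (show 400000 * Z + (1 + 1) + 12 ≤ 500000 * Z by omega)
      rw [Nat.mul_left_comm _ 500000] at h₁
      exact ht.trans h₁
    · have h₁ := card_filter_le D fun d => Y d < θ - 1
      have h₂ := card_filter_le D fun d => Y d < θ + 1
      have := hCh.2.2.2
      omega

theorem exists_approx_program : ∃ (P : RealRAM.Cmd) (K : ℝ),
    ∀ (n : ℕ) (p : Fin n → Plane), Function.Injective p →
      ∃ (t : ℕ) (m : RealRAM.Mem), RealRAM.Exec P (pointsInput p) t m ∧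
        (2 ≤ n → (t : ℝ) ≤ K * ((n : ℝ) ^ 20 * Real.log (n : ℝ))) ∧
        IsDominatingSet (Set.range p) (output p m) ∧
        ∀ OPT : Finset Plane, IsMDS (Set.range p) OPT → (output p m).card ≤ 2 * OPT.card := by
  refine ⟨coverStrips, ((500000 : ℕ) : ℝ) * 2 ^ (20 + 1), fun n p hp => ?_⟩
  set m := pointsInput p with hm
  have hn : m.nat 0 0 = n := by simp [hm, pointsInput]
  have hnat : ∀ A i, A ≠ 0 → m.nat A i = 0 := fun A i hA => by simp [hm, pointsInput, hA]
  have hX : ∀ i : Fin n, m.real 0 i = p i 0 := fun i => by simp [hm, pointsInput]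
  have hY : ∀ i : Fin n, m.real 1 i = p i 1 := fun i => by simp [hm, pointsInput]
  obtain ⟨D, hD⟩ := exists_minDom (X := m.real 0) (Y := m.real 1) (subset_refl (range n))
  obtain ⟨t, m', hex, ht, O, hOn, hdom, hcard, hout⟩ := wp_coverStrips hn hnat hD.2.1 hD.1
  refine ⟨t, m', hex, fun h => time_bound ht h, ⟨output_subset p m', ?_⟩, fun OPT hOPT => ?_⟩
  · refine covers_output hX hY hOn (fun i hi => (hout i).2 hi) hdom ?_
    rintro _ ⟨i, rfl⟩
    exact ⟨i, mem_range.2 i.2, rfl⟩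
  · calc #(output p m') ≤ #O := card_output_le fun i hi => (hout i).1 hi
      _ ≤ 2 * #D := hcard
      _ ≤ 2 * #(indices p OPT) := Nat.mul_le_mul_left _ (hD.2.2 _ (indices_subset OPT)
          (dom_indices hX hY hOPT.1.1 hOPT.1.2 fun t ht =>
            ⟨⟨t, mem_range.1 ht⟩, rfl, ⟨_, rfl⟩⟩))
      _ ≤ 2 * #OPT := Nat.mul_le_mul_left _ (card_indices_le hp OPT)

end GeomMDS

theorem theorem4 :
    (∃ (P : RealRAM.Cmd) (K : ℝ),
      ∀ (n : ℕ) (p : Fin n → GeomMDS.Plane), Function.Injective p →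
        ∀ a : GeomMDS.Plane,
          ∃ (t : ℕ) (m : RealRAM.Mem),
            RealRAM.Exec P (GeomMDS.pointsCellInput p a) t m ∧
            (2 ≤ n → (t : ℝ) ≤ K * ((n : ℝ) ^ 20 * Real.log (n : ℝ))) ∧
            GeomMDS.IsMinCover (Set.range p) (Set.range p ∩ GeomMDS.duperCell a)
              (GeomMDS.output p m)) ∧
    (∃ (P : RealRAM.Cmd) (K : ℝ),
      ∀ (n : ℕ) (p : Fin n → GeomMDS.Plane), Function.Injective p →
        ∃ (t : ℕ) (m : RealRAM.Mem),
          RealRAM.Exec P (GeomMDS.pointsInput p) t m ∧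
          (2 ≤ n → (t : ℝ) ≤ K * ((n : ℝ) ^ 20 * Real.log (n : ℝ))) ∧
          GeomMDS.IsDominatingSet (Set.range p) (GeomMDS.output p m) ∧
          ∀ OPT : Finset GeomMDS.Plane, GeomMDS.IsMDS (Set.range p) OPT →
            ((GeomMDS.output p m).card : ℝ) ≤ 5 / 2 * (OPT.card : ℝ)) := by
  refine ⟨GeomMDS.exists_minCover_program, ?_⟩
  obtain ⟨P, K, h⟩ := GeomMDS.exists_approx_program
  refine ⟨P, K, fun n p hp => ?_⟩
  obtain ⟨t, m, hex, ht, hdom, hopt⟩ := h n p hp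
  refine ⟨t, m, hex, ht, hdom, fun OPT hOPT => ?_⟩
  have h₂ : ((GeomMDS.output p m).card : ℝ) ≤ 2 * (OPT.card : ℝ) := by
    exact_mod_cast hopt OPT hOPT
  have h₃ : (0 : ℝ) ≤ OPT.card := Nat.cast_nonneg _
  linarith
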